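/- Let $\langle \mathbf z,\mathbf w\rangle=\mathbf w^*H\mathbf z$ on $\mathbb C^3$ with $$H=\begin{bmatrix}0&0&1\\0&1&0\\1&0&0\end{bmatrix},$$ let $\mathbf U(2,1)$ be its unitary group and $\mathbf{PU}(2,1)=\mathbf U(2,1)/\mathbf U(1)$, which acts on the complex hyperbolic plane $\mathbf H^2_{\mathbb C}=\{[\mathbf z]\in\mathbb{CP}^2:\langle\mathbf z,\mathbf z\rangle<0\}$. Put $\mathbf q_\infty=(1,0,0)^T$. Consider the complex reflections $$I_1=\begin{bmatrix}-1&2&2\\0&1&2\\0&0&-1\end{bmatrix},\quad I_2=\begin{bmatrix}-1&0&0\\0&1&0\\0&0&-1\end{bmatrix},\quad I_3=\begin{bmatrix}-\frac12&-\frac i2&\frac14\\ i&0&\frac i2\\1&-i&-\frac12\end{bmatrix},$$ which generate the critical complex hyperbolic triangle group $\Delta_{4,\infty,\infty;\infty}$, and let $A=I_1I_2$, $B=I_2I_3$, $\Sigma=\langle A,B\rangle<\mathbf{PU}(2,1)$. The closed exterior of the isometric sphere of $g\in\mathbf U(2,1)$ is $\{p\in\mathbf H^2_{\mathbb C}:|\langle\mathbf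 p,\mathbf q_\infty\rangle|\le|\langle\mathbf p,g^{-1}\mathbf q_\infty\rangle|\}$. Let $D_\Sigma\subset\mathbf H^2_{\mathbb C}$ be the intersection of the closed exteriors of the isometric spheres of $A^kBA^{-k}$, $A^kB^{-1}A^{-k}$ and $A^kB^2A^{-k}$ for all $k\in\mathbb Z$. **Theorem.** The polyhedron $D_\Sigma$ is a fundamental domain for the cosets of $\langle A\rangle$ in $\Sigma$; that is, $D_\Sigma$ is closed, it is the closure of its non-empty connected interior, $gD_\Sigma=D_\Sigma$ for all $g\in\langle A\rangle$, the translates $gD_\Sigma$ with $g\in\Sigma$ cover $\mathbf H^2_{\mathbb C}$ and form a locally finite family of sets, and $D_\Sigma$ and $gD_\Sigma$ have disjoint interiors for all $g\in\Sigma\setminus\langle A\rangle$. Moreover, $\Sigma$ is a discrete subgroup of $\mathbf{PU}(2,1)$ and has the presentation $\langle A,B\mid B^4=\mathrm{id}\rangle$ (on the generators $A$ and $B$). -/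

import Mathlib

open scoped Matrix LinearAlgebra.Projectivization Pointwise

namespace ChainLinks

noncomputable section

/-! ## The group `PU(2,1)` -/

/-- The Hermitian matrix of signature `(2,1)`. -/
def H : Matrix (Fin 3) (Fin 3) ℂ := !![0, 0, 1; 0, 1, 0; 1, 0, 0]

/-- The Hermitian form `⟨z, w⟩ = w* H z`. -/
def herm (z w : Fin 3 → ℂ) : ℂ := star w ⬝ᵥ (H *ᵥ z)

/-- `U(2,1)`, the invertible complex matrices `g` with `g* H g = H`. -/
def U21 : Subgroup (GL (Fin 3) ℂ) where
  carrier := {g | (g : Matrix (Fin 3) (Fin 3) ℂ)ᴴ * H * (g : Matrix (Fin 3) (Fin 3) ℂ) = H}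
  one_mem' := by simp
  mul_mem' := by
    intro a b ha hb
    simp only [Set.mem_ofPred_eq, Units.val_mul, Matrix.conjTranspose_mul] at *
    calc _ = (b : Matrix (Fin 3) (Fin 3) ℂ)ᴴ *
          ((a : Matrix (Fin 3) (Fin 3) ℂ)ᴴ * H * (a : Matrix (Fin 3) (Fin 3) ℂ)) *
          (b : Matrix (Fin 3) (Fin 3) ℂ) := by simp only [Matrix.mul_assoc]
      _ = H := by rw [ha, hb]
  inv_mem' := by
    intro a ha
    simp only [Set.mem_ofPred_eq] at *
    have h1 : (a : Matrix (Fin 3) (Fin 3) ℂ) * ((a⁻¹ : GL (Fin 3) ℂ) : Matrix (Fin 3) (Fin 3) ℂ)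
        = 1 := by rw [← Units.val_mul]; simp
    have h2 : ((a⁻¹ : GL (Fin 3) ℂ) : Matrix (Fin 3) (Fin 3) ℂ)ᴴ *
        (a : Matrix (Fin 3) (Fin 3) ℂ)ᴴ = 1 := by
      rw [← Matrix.conjTranspose_mul, h1, Matrix.conjTranspose_one]
    nth_rewrite 1 [← ha]
    calc _ = (((a⁻¹ : GL (Fin 3) ℂ) : Matrix (Fin 3) (Fin 3) ℂ)ᴴ *
          (a : Matrix (Fin 3) (Fin 3) ℂ)ᴴ) * H * ((a : Matrix (Fin 3) (Fin 3) ℂ) *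
          ((a⁻¹ : GL (Fin 3) ℂ) : Matrix (Fin 3) (Fin 3) ℂ)) := by
            simp only [Matrix.mul_assoc]
      _ = H := by rw [h1, h2]; simp

/-- The underlying matrix of an element of `U(2,1)`. -/
def mat (g : U21) : Matrix (Fin 3) (Fin 3) ℂ := ((g : GL (Fin 3) ℂ) : Matrix (Fin 3) (Fin 3) ℂ)

/-- The scalar matrices in `U(2,1)`. Being in `U(2,1)`, they are the unit scalars, a copy of
`U(1)`. -/
def scalars : Subgroup U21 where
  carrier := {g | ∃ c : ℂ, mat g = c • (1 : Matrix (Fin 3) (Fin 3) ℂ)}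
  one_mem' := ⟨1, by simp [mat]⟩
  mul_mem' := by
    rintro a b ⟨c, hc⟩ ⟨d, hd⟩
    refine ⟨c * d, ?_⟩
    have : mat (a * b) = mat a * mat b := by simp [mat]
    rw [this, hc, hd]
    simp [smul_smul, mul_comm]
  inv_mem' := by
    rintro a ⟨c, hc⟩
    have h1 : mat a * mat a⁻¹ = 1 := by
      simp only [mat]
      rw [← Units.val_mul, ← Subgroup.coe_mul]
      simp
    refine ⟨c⁻¹, ?_⟩
    rw [hc, Matrix.smul_mul, Matrix.one_mul] at h1
    have hc0 : c ≠ 0 := by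
      rintro rfl
      rw [zero_smul] at h1
      exact zero_ne_one h1
    rw [← h1, smul_smul, inv_mul_cancel₀ hc0, one_smul]

instance : scalars.Normal where
  conj_mem := by
    rintro n ⟨c, hc⟩ g
    refine ⟨c, ?_⟩
    have h1 : mat g * mat g⁻¹ = 1 := by
      simp only [mat]
      rw [← Units.val_mul, ← Subgroup.coe_mul]
      simp
    have h2 : mat (g * n * g⁻¹) = mat g * mat n * mat g⁻¹ := by simp [mat]
    rw [h2, hc]
    simp [h1]

/-- `PU(2,1) = U(2,1) / U(1)`, with the quotient group structure and the quotient topology. -/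
abbrev PU21 : Type := U21 ⧸ scalars

/-! ## The complex hyperbolic plane -/

/-- The complex projective plane. -/
abbrev CP2 : Type := ℙ ℂ (Fin 3 → ℂ)

/-- The quotient topology on the complex projective plane. -/
instance : TopologicalSpace CP2 :=
  inferInstanceAs (TopologicalSpace (Quotient (projectivizationSetoid ℂ (Fin 3 → ℂ))))

/-- The complex hyperbolic plane: the lines spanned by negative vectors, as a subspace of the
projective plane. -/
abbrev H2C : Type := {p : CP2 // (herm p.rep p.rep).re < 0}

/-- Scaling a vector multiplies `⟨v, v⟩` by a positive factor. -/
theorem herm_smul_self (c : ℂ) (v : Fin 3 → ℂ) :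
    (herm (c • v) (c • v)).re = Complex.normSq c * (herm v v).re := by
  have : herm (c • v) (c • v) = (Complex.normSq c : ℂ) * herm v v := by
    rw [Complex.normSq_eq_conj_mul_self]
    simp only [herm, Matrix.mulVec_smul, star_smul, smul_dotProduct, dotProduct_smul, smul_eq_mul,
      Complex.star_def]
    ring
  rw [this, Complex.re_ofReal_mul]

/-- Negativity does not depend on the lift. -/
theorem neg_mk_iff (v : Fin 3 → ℂ) (hv : v ≠ 0) :
    (herm (Projectivization.mk ℂ v hv).rep (Projectivization.mk ℂ v hv).rep).re < 0 ↔
      (herm v v).re < 0 := by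
  obtain ⟨c, hc⟩ := Projectivization.exists_smul_eq_mk_rep ℂ v hv
  rw [← hc, Units.smul_def, herm_smul_self]
  have hpos := Complex.normSq_pos.2 c.ne_zero
  constructor
  · intro h
    by_contra h'
    exact absurd h (not_lt.2 (mul_nonneg hpos.le (not_lt.1 h')))
  · intro h
    exact mul_neg_of_pos_of_neg hpos h

/-- `U(2,1)` preserves the Hermitian form. -/
theorem herm_mulVec (g : U21) (v w : Fin 3 → ℂ) :
    herm (mat g *ᵥ v) (mat g *ᵥ w) = herm v w := by
  have hg : (mat g)ᴴ * H * mat g = H := g.2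
  simp only [herm]
  rw [Matrix.star_mulVec, ← Matrix.dotProduct_mulVec, Matrix.mulVec_mulVec, Matrix.mulVec_mulVec,
    hg]

/-- The projective transformation of a matrix in `U(2,1)`. -/
def projAct (g : U21) : CP2 → CP2 :=
  fun p => Matrix.GeneralLinearGroup.toLin (g : GL (Fin 3) ℂ) • p

theorem projAct_mk (g : U21) (v : Fin 3 → ℂ) (hv : v ≠ 0) (hgv : mat g *ᵥ v ≠ 0) :
    projAct g (Projectivization.mk ℂ v hv) = Projectivization.mk ℂ (mat g *ᵥ v) hgv := rfl

theorem mat_mulVec_ne_zero (g : U21) {v : Fin 3 → ℂ} (hv : v ≠ 0) : mat g *ᵥ v ≠ 0 := by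
  intro h
  apply hv
  have h1 : mat g⁻¹ * mat g = 1 := by
    simp only [mat]
    rw [← Units.val_mul, ← Subgroup.coe_mul]
    simp
  have := congrArg (fun w => mat g⁻¹ *ᵥ w) h
  simpa [Matrix.mulVec_mulVec, h1] using this

theorem projAct_neg (g : U21) (p : CP2) (hp : (herm p.rep p.rep).re < 0) :
    (herm (projAct g p).rep (projAct g p).rep).re < 0 := by
  have : projAct g p = Projectivization.mk ℂ (mat g *ᵥ p.rep)
      (mat_mulVec_ne_zero g p.rep_nonzero) := by
    conv_lhs => rw [← p.mk_rep]
    rfl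
  rw [this, neg_mk_iff, herm_mulVec]
  exact hp

/-- The action of `U(2,1)` on the complex hyperbolic plane. -/
instance : MulAction U21 H2C where
  smul g p := ⟨projAct g p.1, projAct_neg g p.1 p.2⟩
  one_smul p := Subtype.ext (by
    change Matrix.GeneralLinearGroup.toLin ((1 : U21) : GL (Fin 3) ℂ) • p.1 = p.1
    rw [Subgroup.coe_one, map_one, one_smul])
  mul_smul g h p := Subtype.ext (by
    change Matrix.GeneralLinearGroup.toLin ((g * h : U21) : GL (Fin 3) ℂ) • p.1 =
      Matrix.GeneralLinearGroup.toLin (g : GL (Fin 3) ℂ) •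
        (Matrix.GeneralLinearGroup.toLin (h : GL (Fin 3) ℂ) • p.1)
    rw [Subgroup.coe_mul, map_mul, mul_smul])

theorem scalars_le_ker : scalars ≤ (MulAction.toPermHom U21 H2C).ker := by
  rintro g ⟨c, hc⟩
  rw [MonoidHom.mem_ker]
  refine Equiv.ext fun p => Subtype.ext ?_
  change projAct g p.1 = p.1
  have : projAct g p.1 = Projectivization.mk ℂ (mat g *ᵥ p.1.rep)
      (mat_mulVec_ne_zero g p.1.rep_nonzero) := by
    conv_lhs => rw [← p.1.mk_rep]
    rfl
  rw [this]
  conv_rhs => rw [← p.1.mk_rep]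
  rw [Projectivization.mk_eq_mk_iff']
  exact ⟨c, by rw [hc, Matrix.smul_mulVec, Matrix.one_mulVec]⟩

/-- The induced action of `PU(2,1)` on the complex hyperbolic plane. -/
instance : MulAction PU21 H2C :=
  MulAction.compHom H2C
    (QuotientGroup.lift scalars (MulAction.toPermHom U21 H2C) scalars_le_ker)

/-! ## Exteriors of isometric spheres -/

/-- The lift `(1, 0, 0)` of the point at infinity. -/
def qInf : Fin 3 → ℂ := ![1, 0, 0]

/-- The closed exterior, in the complex hyperbolic plane, of the isometric sphere
`I(g) = {p | |⟨p, q∞⟩| = |⟨p, g⁻¹ q∞⟩|}`. The condition does not depend on the lift of `p`. -/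
def closedExterior (g : U21) : Set H2C :=
  {p | ‖herm p.1.rep qInf‖ ≤ ‖herm p.1.rep (mat g⁻¹ *ᵥ qInf)‖}

/-- The closed exterior can be tested on any lift. -/
theorem mem_closedExterior_iff (g : U21) (p : H2C) (v : Fin 3 → ℂ) (hv : v ≠ 0)
    (h : p.1 = Projectivization.mk ℂ v hv) :
    p ∈ closedExterior g ↔ ‖herm v qInf‖ ≤ ‖herm v (mat g⁻¹ *ᵥ qInf)‖ := by
  obtain ⟨c, hc⟩ := Projectivization.exists_smul_eq_mk_rep ℂ v hv
  have e : ∀ w, herm (c • v) w = c * herm v w := by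
    intro w
    simp [herm, Units.smul_def, Matrix.mulVec_smul]
  simp only [closedExterior, Set.mem_ofPred_eq, h, ← hc, e, norm_mul]
  exact mul_le_mul_iff_right₀ (by simp)

/-! ## The generators of the triangle group -/

/-- The matrix of the complex reflection `I₁`. -/
def matI1 : Matrix (Fin 3) (Fin 3) ℂ := !![-1, 2, 2; 0, 1, 2; 0, 0, -1]

/-- The matrix of the complex reflection `I₂`. -/
def matI2 : Matrix (Fin 3) (Fin 3) ℂ := !![-1, 0, 0; 0, 1, 0; 0, 0, -1]

/-- The matrix of the complex reflection `I₃`. -/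
def matI3 : Matrix (Fin 3) (Fin 3) ℂ :=
  !![-1 / 2, -Complex.I / 2, 1 / 4; Complex.I, 0, Complex.I / 2; 1, -Complex.I, -1 / 2]

theorem matI1_sq : matI1 * matI1 = 1 := by
  ext i j
  fin_cases i <;> fin_cases j <;> simp [matI1, Matrix.mul_apply, Fin.sum_univ_three]; norm_num

theorem matI2_sq : matI2 * matI2 = 1 := by
  ext i j
  fin_cases i <;> fin_cases j <;> simp [matI2, Matrix.mul_apply, Fin.sum_univ_three]

theorem matI3_sq : matI3 * matI3 = 1 := by
  ext i j
  fin_cases i <;> fin_cases j <;>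
    simp [matI3, Matrix.mul_apply, Fin.sum_univ_three, Complex.ext_iff] <;> norm_num

/-- The complex reflection `I₁`, an element of `U(2,1)` equal to its own inverse. -/
def I1 : U21 := ⟨⟨matI1, matI1, matI1_sq, matI1_sq⟩, by
  change matI1ᴴ * H * matI1 = H
  ext i j
  fin_cases i <;> fin_cases j <;>
    simp [matI1, H, Matrix.mul_apply, Fin.sum_univ_three, Complex.conj_ofNat] <;> norm_num⟩

/-- The complex reflection `I₂`. -/
def I2 : U21 := ⟨⟨matI2, matI2, matI2_sq, matI2_sq⟩, by
  change matI2ᴴ * H * matI2 = H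
  ext i j
  fin_cases i <;> fin_cases j <;>
    simp [matI2, H, Matrix.mul_apply, Fin.sum_univ_three]⟩

/-- The complex reflection `I₃`. -/
def I3 : U21 := ⟨⟨matI3, matI3, matI3_sq, matI3_sq⟩, by
  change matI3ᴴ * H * matI3 = H
  ext i j
  fin_cases i <;> fin_cases j <;>
    simp [matI3, H, Matrix.mul_apply, Fin.sum_univ_three, Complex.ext_iff, Complex.conj_ofNat] <;> norm_num⟩

/-- `A = I₁I₂`, as a matrix in `U(2,1)`. -/
def A : U21 := I1 * I2

/-- `B = I₂I₃`, as a matrix in `U(2,1)`. -/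
def B : U21 := I2 * I3

/-- The class of `A` in `PU(2,1)`. -/
def pA : PU21 := QuotientGroup.mk A

/-- The class of `B` in `PU(2,1)`. -/
def pB : PU21 := QuotientGroup.mk B

/-- `Σ = ⟨A, B⟩`, as a subgroup of `PU(2,1)`. -/
def Sig : Subgroup PU21 := Subgroup.closure {pA, pB}

/-- The polyhedron `D_Σ`: the intersection of the closed exteriors of the isometric spheres of
`A^k B A^{-k}`, `A^k B^{-1} A^{-k}` and `A^k B^2 A^{-k}`, for all integers `k`. -/
def DSig : Set H2C :=
  ⋂ k : ℤ, closedExterior (A ^ k * B * A ^ (-k)) ∩ closedExterior (A ^ k * B⁻¹ * A ^ (-k)) ∩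
    closedExterior (A ^ k * B ^ 2 * A ^ (-k))

/-! ## Fundamental domains for coset decompositions -/

/-- `D` is a fundamental domain for the cosets of the subgroup `K` in `G`: a closed domain, the
closure of its connected non-empty interior, which is preserved by `K`, and whose translates by the
cosets of `K` in `G` form a locally finite tiling of the complex hyperbolic plane. -/
structure IsFundamentalDomainForCosets (K G : Subgroup PU21) (D : Set H2C) : Prop where
  le : K ≤ G
  isClosed : IsClosed D
  connected_interior : IsConnected (interior D)
  closure_interior : closure (interior D) = D
  invariant : ∀ g ∈ K, g • D = D
  covers : ∀ p : H2C, ∃ g ∈ G, p ∈ g • D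
  disjoint : ∀ g ∈ G, g ∉ K → Disjoint (interior D) (interior (g • D))
  locallyFinite : ∀ p : H2C, ∃ U ∈ nhds p,
    {E : Set H2C | (∃ g ∈ G, E = g • D) ∧ (E ∩ U).Nonempty}.Finite

end

end ChainLinks

namespace ChainLinks

/-! ## Horospherical functions -/

/-! The modulus |⟨v, g q∞⟩|, called `horo v g`, measures how far v is from the orbit point g q∞, and
everything is read off from comparing these numbers. Since A fixes q∞, the polyhedron is the set
where g = 1 does at least as well as every A^k B^j with j = 1, 2, 3. The heart of the matter is that
it then does at least as well as every element of Σ, so that D_Σ is a Ford domain and its translates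
are the cells of the orbit of q∞.

This is a ping-pong argument. The inequalities fail on balls for the extended Cygan distance; by
`norm_herm_le` and `norm_herm_cusp_ge` the balls of B, B², B³ do not overlap their translates under
A^k, k ≠ 0. Peeling syllables off an alternating word (`StartsB.exists_horo_le`), each step leaves
one family of balls and stays outside the next. The strict form of the inequality gives both
disjoint interiors and faithfulness of the abstract group ⟨a, b | b⁴⟩.

Covering, local finiteness and discreteness are arithmetic: Σ preserves a lattice over the Gaussian
integers, so only finitely many orbit points are close to a bounded set of negative vectors
(`finite_orbit`) and a closest one exists. The topology of D_Σ comes from a vertical flow towards q∞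
which pushes D_Σ into its interior. -/

theorem mat_mul (g h : U21) : mat (g * h) = mat g * mat h := rfl

theorem mat_one : mat 1 = 1 := rfl

theorem mat_injective : Function.Injective mat := fun _ _ h => Subtype.ext (Units.ext h)

theorem herm_apply (v w : Fin 3 → ℂ) :
    herm v w = star (w 0) * v 2 + star (w 1) * v 1 + star (w 2) * v 0 := by
  simp [herm, H, dotProduct, Matrix.mulVec, Fin.sum_univ_three]

theorem herm_self_re (v : Fin 3 → ℂ) :
    (herm v v).re = 2 * (star (v 2) * v 0).re + Complex.normSq (v 1) := by
  simp [herm_apply, Complex.normSq_apply]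
  ring

/-- The modulus of `⟨v, g q∞⟩`. -/
noncomputable def horo (v : Fin 3 → ℂ) (g : U21) : ℝ := ‖herm v (mat g *ᵥ qInf)‖

theorem horo_mulVec (h : U21) (v : Fin 3 → ℂ) (g : U21) :
    horo (mat h *ᵥ v) g = horo v (h⁻¹ * g) := by
  have : mat g *ᵥ qInf = mat h *ᵥ (mat (h⁻¹ * g) *ᵥ qInf) := by
    rw [Matrix.mulVec_mulVec, ← mat_mul, mul_inv_cancel_left]
  rw [horo, this, herm_mulVec, horo]

theorem herm_smul_left (c : ℂ) (v w : Fin 3 → ℂ) : herm (c • v) w = c * herm v w := by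
  simp [herm_apply]; ring

theorem horo_smul (c : ℂ) (v : Fin 3 → ℂ) (g : U21) : horo (c • v) g = ‖c‖ * horo v g := by
  rw [horo, herm_smul_left, norm_mul, horo]

theorem horo_one (v : Fin 3 → ℂ) : horo v 1 = ‖v 2‖ := by
  simp [horo, mat_one, herm_apply, qInf]

theorem apply_two_ne_zero {v : Fin 3 → ℂ} (hv : (herm v v).re < 0) : v 2 ≠ 0 := by
  intro h
  rw [herm_self_re, h] at hv
  simp at hv
  exact absurd hv (not_lt.2 (Complex.normSq_nonneg _))

theorem ne_zero_of_neg {v : Fin 3 → ℂ} (hv : (herm v v).re < 0) : v ≠ 0 :=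
  fun h => apply_two_ne_zero hv (by simp [h])

/-- The scaling of a negative vector which has last coordinate `1`. -/
noncomputable def normalize (v : Fin 3 → ℂ) : Fin 3 → ℂ := (v 2)⁻¹ • v

theorem normalize_two {v : Fin 3 → ℂ} (hv : (herm v v).re < 0) : normalize v 2 = 1 := by
  simp [normalize, inv_mul_cancel₀ (apply_two_ne_zero hv)]

theorem normalize_neg {v : Fin 3 → ℂ} (hv : (herm v v).re < 0) :
    (herm (normalize v) (normalize v)).re < 0 := by
  rw [normalize, herm_smul_self]
  exact mul_neg_of_pos_of_neg
    (Complex.normSq_pos.2 (inv_ne_zero (apply_two_ne_zero hv))) hv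

/-! ## The generators -/

theorem mat_A : mat A = !![1, 2, -2; 0, 1, -2; 0, 0, 1] := by
  change matI1 * matI2 = _
  ext i j
  fin_cases i <;> fin_cases j <;> simp [matI1, matI2, Matrix.mul_apply, Fin.sum_univ_three]

theorem mat_B : mat B = !![1 / 2, Complex.I / 2, -1 / 4; Complex.I, 0, Complex.I / 2;
    -1, Complex.I, 1 / 2] := by
  change matI2 * matI3 = _
  ext i j
  fin_cases i <;> fin_cases j <;>
    simp [matI2, matI3, Matrix.mul_apply, Fin.sum_univ_three] <;> ring

theorem mat_B_sq : mat (B ^ 2) = !![0, 0, -1 / 2; 0, -1, 0; -2, 0, 0] := by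
  rw [pow_two, mat_mul, mat_B]
  ext i j
  fin_cases i <;> fin_cases j <;>
    simp [Matrix.mul_apply, Fin.sum_univ_three, Complex.ext_iff] <;> norm_num

theorem B_pow_four : B ^ 4 = 1 := by
  apply mat_injective
  rw [show B ^ 4 = B ^ 2 * B ^ 2 by group, mat_mul, mat_B_sq, mat_one]
  ext i j
  fin_cases i <;> fin_cases j <;> simp [Matrix.mul_apply, Fin.sum_univ_three]
  norm_num

theorem mat_A_inv : mat A⁻¹ = !![1, -2, -2; 0, 1, 2; 0, 0, 1] := by
  have h : mat A * !![1, -2, -2; 0, 1, 2; 0, 0, 1] = 1 := by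
    rw [mat_A]
    ext i j
    fin_cases i <;> fin_cases j <;> simp [Matrix.mul_apply, Fin.sum_univ_three]
    norm_num
  have h' : mat A⁻¹ * mat A = 1 := by rw [← mat_mul, inv_mul_cancel, mat_one]
  calc mat A⁻¹ = mat A⁻¹ * (mat A * !![1, -2, -2; 0, 1, 2; 0, 0, 1]) := by rw [h, mul_one]
    _ = _ := by rw [← mul_assoc, h', one_mul]

theorem mat_A_zpow (k : ℤ) :
    mat (A ^ k) = !![1, 2 * (k : ℂ), -2 * (k : ℂ) ^ 2; 0, 1, -2 * (k : ℂ); 0, 0, 1] := by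
  induction k using Int.induction_on with
  | zero =>
    rw [zpow_zero, mat_one]
    ext i j
    fin_cases i <;> fin_cases j <;> simp
  | succ n ih =>
    rw [zpow_add_one, mat_mul, ih, mat_A]
    ext i j
    fin_cases i <;> fin_cases j <;> simp [Matrix.mul_apply, Fin.sum_univ_three] <;> ring
  | pred n ih =>
    rw [zpow_sub_one, mat_mul, ih, mat_A_inv]
    ext i j
    fin_cases i <;> fin_cases j <;> simp [Matrix.mul_apply, Fin.sum_univ_three] <;> ring

theorem mat_A_zpow_qInf (k : ℤ) : mat (A ^ k) *ᵥ qInf = qInf := by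
  rw [mat_A_zpow]
  ext i
  fin_cases i <;> simp [qInf, Matrix.mulVec, dotProduct, Fin.sum_univ_three]

theorem horo_mul_A_zpow (v : Fin 3 → ℂ) (g : U21) (k : ℤ) : horo v (g * A ^ k) = horo v g := by
  rw [horo, mat_mul, ← Matrix.mulVec_mulVec, mat_A_zpow_qInf, horo]

theorem horo_A_zpow (v : Fin 3 → ℂ) (k : ℤ) : horo v (A ^ k) = horo v 1 := by
  rw [← one_mul (A ^ k), horo_mul_A_zpow]

/-! ## Centres of the isometric spheres -/

/-- The image under `A ^ k` of the boundary point with horizontal coordinate `s * i`. -/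
noncomputable def cusp (k s : ℤ) : Fin 3 → ℂ :=
  ![-(s : ℂ) ^ 2 / 2 + 2 * k * s * Complex.I - 2 * (k : ℂ) ^ 2, s * Complex.I - 2 * k, 1]

/-- The reciprocal of the squared radius of the isometric sphere about `cusp k s`. -/
def weight (s : ℤ) : ℝ := if s = 0 then 2 else 1

theorem one_le_weight (s : ℤ) : 1 ≤ weight s := by
  unfold weight; split_ifs <;> norm_num

/-- The subtraction `j - 2` takes place in ℤ: the powers B, B², B³ correspond to s = -1, 0, 1. -/
theorem mat_mulVec_qInf (k : ℤ) {j : ℕ} (h1 : 1 ≤ j) (h3 : j ≤ 3) :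
    mat (A ^ k * B ^ j) *ᵥ qInf = (-(weight (j - 2) : ℂ)) • cusp k (j - 2) := by
  have hB : mat B *ᵥ qInf = ![1 / 2, Complex.I, -1] := by
    rw [mat_B]
    ext i
    fin_cases i <;> simp [qInf, Matrix.mulVec, dotProduct, Fin.sum_univ_three]
  interval_cases j
  · rw [pow_one, mat_mul, ← Matrix.mulVec_mulVec, hB, mat_A_zpow]
    ext i
    fin_cases i <;>
      simp [cusp, weight, Matrix.mulVec, dotProduct, Fin.sum_univ_three] <;> ring
  · rw [mat_mul, mat_B_sq, ← Matrix.mulVec_mulVec, mat_A_zpow]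
    ext i
    fin_cases i <;>
      simp [cusp, weight, qInf, Matrix.mulVec, dotProduct, Fin.sum_univ_three]
    all_goals ring
  · rw [show B ^ 3 = B ^ 2 * B by group, mat_mul, mat_mul, mat_B_sq, ← Matrix.mulVec_mulVec,
      ← Matrix.mulVec_mulVec, hB, mat_A_zpow]
    ext i
    fin_cases i <;>
      simp [cusp, weight, Matrix.mulVec, dotProduct, Fin.sum_univ_three] <;> ring

theorem horo_eq (v : Fin 3 → ℂ) (k : ℤ) {j : ℕ} (h1 : 1 ≤ j) (h3 : j ≤ 3) :
    horo v (A ^ k * B ^ j) = weight (j - 2) * ‖herm v (cusp k (j - 2))‖ := by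
  rw [horo, mat_mulVec_qInf k h1 h3]
  have : herm v (-(weight (j - 2) : ℂ) • cusp k (j - 2)) =
      (-(weight (j - 2) : ℂ)) * herm v (cusp k (j - 2)) := by
    simp [herm_apply]; ring
  rw [this, norm_mul, norm_neg, Complex.norm_real, Real.norm_of_nonneg
    (zero_le_one.trans (one_le_weight _))]

theorem cusp_two (k s : ℤ) : cusp k s 2 = 1 := rfl

theorem herm_cusp_self (k s : ℤ) : (herm (cusp k s) (cusp k s)).re = 0 := by
  rw [herm_self_re]
  simp [cusp, Complex.normSq_apply, pow_two]
  ring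

/-- For lifts with last coordinate `1`, the real part of the form is a distance. -/
theorem herm_re_of_null {v w : Fin 3 → ℂ} (hv : v 2 = 1) (hw : w 2 = 1)
    (hw0 : (herm w w).re = 0) :
    2 * (herm v w).re = (herm v v).re - Complex.normSq (v 1 - w 1) := by
  rw [herm_self_re] at *
  rw [herm_apply]
  simp [hv, hw, Complex.normSq_apply] at *
  linarith

/-- The triangle inequality for the extended Cygan distance. -/
theorem norm_herm_le {v p q : Fin 3 → ℂ} (hv : v 2 = 1) (hp : p 2 = 1) (hq : q 2 = 1)
    (hv0 : (herm v v).re < 0) (hp0 : (herm p p).re = 0) (hq0 : (herm q q).re = 0) :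
    ‖herm p q‖ ≤ (√‖herm v p‖ + √‖herm v q‖) ^ 2 := by
  -- Both bounds follow from 2 Re⟨v, w⟩ = ⟨v, v⟩ - |v₁ - w₁|² with ⟨v, v⟩ < 0: moving ⟨v, w⟩ by -⟨v,
  -- v⟩/2 brings its real part closer to zero.
  have key : ∀ w : Fin 3 → ℂ, w 2 = 1 → (herm w w).re = 0 →
      ‖w 1 - v 1‖ ≤ √2 * √‖herm v w‖ ∧
      ‖herm v w - ((herm v v).re / 2 : ℝ)‖ ≤ ‖herm v w‖ := by
    intro w hw hw0
    have h := herm_re_of_null hv hw hw0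
    have h' : Complex.normSq (v 1 - w 1) = ‖w 1 - v 1‖ ^ 2 := by
      rw [← Complex.normSq_eq_norm_sq, ← Complex.normSq_neg, neg_sub]
    have h2 : |(herm v w).re| ≤ ‖herm v w‖ := Complex.abs_re_le_norm _
    constructor
    · rw [← Real.sqrt_mul (by norm_num)]
      apply Real.le_sqrt_of_sq_le
      have := neg_abs_le (herm v w).re
      linarith
    · rw [← sq_le_sq₀ (norm_nonneg _) (norm_nonneg _), ← Complex.normSq_eq_norm_sq,
        ← Complex.normSq_eq_norm_sq, Complex.normSq_apply, Complex.normSq_apply]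
      simp only [Complex.sub_re, Complex.sub_im, Complex.ofReal_re, Complex.ofReal_im, sub_zero]
      have := Complex.normSq_nonneg (v 1 - w 1)
      nlinarith
  obtain ⟨p1, p2⟩ := key p hp hp0
  obtain ⟨q1, q2⟩ := key q hq hq0
  have e : herm p q = star (q 1 - v 1) * (p 1 - v 1) + (herm v q - ((herm v v).re / 2 : ℝ))
      + star (herm v p - ((herm v v).re / 2 : ℝ)) := by
    rw [herm_self_re, herm_apply, herm_apply, herm_apply, hv, hp, hq]
    apply Complex.ext <;> simp [Complex.normSq_apply] <;> ring
  have h2 : √2 * √2 = (2 : ℝ) := Real.mul_self_sqrt (by norm_num)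
  calc ‖herm p q‖ ≤ ‖q 1 - v 1‖ * ‖p 1 - v 1‖ + ‖herm v q‖ + ‖herm v p‖ := by
        rw [e]
        refine (norm_add₃_le).trans ?_
        rw [norm_mul, norm_star, norm_star]
        gcongr
    _ ≤ (√2 * √‖herm v q‖) * (√2 * √‖herm v p‖) + ‖herm v q‖ + ‖herm v p‖ := by gcongr
    _ = (√2 * √2) * (√‖herm v q‖ * √‖herm v p‖) + √‖herm v q‖ ^ 2 + √‖herm v p‖ ^ 2 := by
        rw [Real.sq_sqrt (norm_nonneg _), Real.sq_sqrt (norm_nonneg _)]; ring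
    _ = _ := by rw [h2]; ring

theorem normSq_herm_cusp (k s t : ℤ) : Complex.normSq (herm (cusp 0 s) (cusp k t)) =
    (((s : ℝ) - t) ^ 2 / 2 + 2 * (k : ℝ) ^ 2) ^ 2 + 4 * (k : ℝ) ^ 2 * ((s : ℝ) + t) ^ 2 := by
  rw [herm_apply]
  simp [cusp, Complex.normSq_apply, pow_two]
  ring

/-- The isometric spheres about `cusp 0 s` and `cusp k t` bound disjoint balls. -/
theorem norm_herm_cusp_ge {k s t : ℤ} (hk : k ≠ 0) (hs : |s| ≤ 1) (ht : |t| ≤ 1) :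
    (√(weight s)⁻¹ + √(weight t)⁻¹) ^ 2 ≤ ‖herm (cusp 0 s) (cusp k t)‖ := by
  have hk2 : (1 : ℝ) ≤ (k : ℝ) ^ 2 := by
    exact_mod_cast Int.one_le_abs hk |>.trans (by rw [← sq_abs]; nlinarith [Int.one_le_abs hk])
  have hq : √(2 : ℝ)⁻¹ ^ 2 = 2⁻¹ := Real.sq_sqrt (by norm_num)
  have hq0 : 0 ≤ √(2 : ℝ)⁻¹ := Real.sqrt_nonneg _
  have hw : weight 0 = 2 ∧ weight 1 = 1 ∧ weight (-1) = 1 := by simp [weight]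
  have hn := Complex.normSq_eq_norm_sq (herm (cusp 0 s) (cusp k t))
  rw [normSq_herm_cusp] at hn
  refine (pow_le_pow_iff_left₀ (sq_nonneg _) (norm_nonneg _) two_ne_zero).1 ?_
  rw [← hn]
  obtain ⟨s1, s2⟩ := abs_le.1 hs
  obtain ⟨t1, t2⟩ := abs_le.1 ht
  clear hn
  -- From here on only k² ≥ 1 matters. Equality is attained at k² = 1 for s = t = 0 and for {s, t} =
  -- {1, -1}, where the spheres are tangent.
  generalize (k : ℝ) ^ 2 = q at *
  have hr : √(2 : ℝ)⁻¹ ≤ 3 / 4 := by nlinarith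
  -- The mixed case, one of s, t being 0, needs at most (1/2 + 2)² + 4 = 41/4, so the crude bound 10
  -- suffices.
  have h34 : ((1 + √(2 : ℝ)⁻¹) ^ 2) ^ 2 ≤ 10 := by
    have h : (1 + √(2 : ℝ)⁻¹) ^ 2 ≤ 3 + 1 / 16 := by nlinarith
    nlinarith [sq_nonneg (1 + √(2 : ℝ)⁻¹)]
  have h22 : ((√(2 : ℝ)⁻¹ + √(2 : ℝ)⁻¹) ^ 2) ^ 2 = 4 := by
    rw [show ((√(2 : ℝ)⁻¹ + √(2 : ℝ)⁻¹) ^ 2) ^ 2 = 16 * (√(2 : ℝ)⁻¹ ^ 2) ^ 2 by ring, hq]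
    norm_num
  interval_cases s <;> interval_cases t <;>
    simp only [hw, inv_one, Real.sqrt_one, h22, add_comm (√(2 : ℝ)⁻¹) 1] <;> push_cast <;> nlinarith

theorem sqrt_norm_le {x r : ℝ} (hr : 0 < r) (h : r * x ≤ 1) : √x ≤ √r⁻¹ :=
  Real.sqrt_le_sqrt (by rwa [← one_div, le_div_iff₀ hr, mul_comm])

theorem sqrt_norm_lt {x r : ℝ} (hr : 0 < r) (h : r * x < 1) : √x < √r⁻¹ :=
  Real.sqrt_lt_sqrt_iff_of_pos (inv_pos.2 hr) |>.2 (by rwa [← one_div, lt_div_iff₀ hr, mul_comm])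

/-- The balls bounded by the isometric spheres are disjoint from their translates under `A ^ k`. -/
theorem horo_one_le_of_le {v : Fin 3 → ℂ} (hv : (herm v v).re < 0) {k : ℤ} (hk : k ≠ 0)
    {i j : ℕ} (hi : 1 ≤ i) (hi' : i ≤ 3) (hj : 1 ≤ j) (hj' : j ≤ 3)
    -- The hypothesis is a closed ball; the negated conclusion is an open one. This asymmetry makes
    -- tangent spheres harmless.
    (h : horo v (B ^ i) ≤ horo v 1) : horo v 1 ≤ horo v (A ^ k * B ^ j) := by
  have hpos : 0 < ‖(v 2)⁻¹‖ := norm_pos_iff.2 (inv_ne_zero (apply_two_ne_zero hv))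
  rw [← mul_le_mul_iff_right₀ hpos, ← horo_smul, ← horo_smul] at h ⊢
  change horo (normalize v) _ ≤ horo (normalize v) _ at h
  change horo (normalize v) _ ≤ horo (normalize v) _
  have hn2 := normalize_two hv
  have hn := normalize_neg hv
  set w := normalize v
  rw [horo_one, hn2, norm_one] at h ⊢
  rw [← one_mul (B ^ i), ← zpow_zero A, horo_eq w 0 hi hi'] at h
  rw [horo_eq w k hj hj']
  by_contra! h'
  have a1 := sqrt_norm_le (zero_lt_one.trans_le (one_le_weight _)) h
  have a2 := sqrt_norm_lt (zero_lt_one.trans_le (one_le_weight _)) h'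
  have a3 := norm_herm_le hn2 (cusp_two 0 (i - 2)) (cusp_two k (j - 2)) hn (herm_cusp_self _ _)
    (herm_cusp_self _ _)
  have a4 := norm_herm_cusp_ge (s := i - 2) (t := j - 2) hk (abs_le.2 ⟨by omega, by omega⟩)
    (abs_le.2 ⟨by omega, by omega⟩)
  exact absurd (a4.trans a3) (not_le.2 (pow_lt_pow_left₀ (add_lt_add_of_le_of_lt a1 a2)
    (by positivity) two_ne_zero))

/-! ## Normal forms -/

/-- The abstract group `⟨a, b | b ^ 4⟩`. -/
abbrev FG : Type := PresentedGroup ({FreeGroup.of 1 ^ 4} : Set (FreeGroup (Fin 2)))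

/-- The generator `a`. -/
def ga : FG := PresentedGroup.of 0

/-- The generator `b`. -/
def gb : FG := PresentedGroup.of 1

theorem gb_pow_four : gb ^ 4 = 1 :=
  PresentedGroup.one_of_mem (rels := ({FreeGroup.of 1 ^ 4} : Set (FreeGroup (Fin 2)))) rfl

theorem gb_inv : gb⁻¹ = gb * gb * gb := by
  rw [inv_eq_iff_mul_eq_one, ← gb_pow_four]
  simp only [pow_succ, pow_zero, one_mul, mul_assoc]

/-- Alternating words in `a` and `b` which start with `b`. -/
inductive StartsB : FG → Prop
  | base {j : ℕ} (k : ℤ) : 1 ≤ j → j ≤ 3 → StartsB (gb ^ j * ga ^ k)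
  | step {j : ℕ} {k : ℤ} {x : FG} : 1 ≤ j → j ≤ 3 → k ≠ 0 → StartsB x →
      StartsB (gb ^ j * ga ^ k * x)

/-- Elements in normal form. -/
def Normal (x : FG) : Prop := (∃ k : ℤ, x = ga ^ k) ∨ ∃ (k : ℤ) (y : FG), StartsB y ∧ x = ga ^ k * y

theorem Normal.ga_zpow_mul {x : FG} (h : Normal x) (n : ℤ) : Normal (ga ^ n * x) := by
  rcases h with ⟨k, rfl⟩ | ⟨k, y, hy, rfl⟩
  · exact Or.inl ⟨n + k, by rw [zpow_add]⟩
  · exact Or.inr ⟨n + k, y, hy, by rw [zpow_add, mul_assoc]⟩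

theorem StartsB.normal {x : FG} (h : StartsB x) : Normal x := Or.inr ⟨0, x, h, by simp⟩

/-- A new b only changes the leading syllable b^j; when j = 3 the syllable becomes b⁴ = 1 and the
next power of a comes to the front. -/
theorem Normal.gb_mul {x : FG} (h : Normal x) : Normal (gb * x) := by
  rcases h with ⟨k, rfl⟩ | ⟨k, y, hy, rfl⟩
  · simpa using (StartsB.base (j := 1) k le_rfl (by norm_num)).normal
  · by_cases hk : k = 0
    · subst hk
      rw [zpow_zero, one_mul]
      cases hy with
      | @base j k h1 h3 =>
        rw [← mul_assoc, ← pow_succ']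
        rcases h3.lt_or_eq with h | rfl
        · exact (StartsB.base k (by omega) (by omega)).normal
        · rw [gb_pow_four, one_mul]
          exact Or.inl ⟨k, rfl⟩
      | @step j k x h1 h3 hk hx =>
        rw [mul_assoc, ← mul_assoc, ← pow_succ']
        rcases h3.lt_or_eq with h | rfl
        · rw [← mul_assoc]
          exact (StartsB.step (by omega) (by omega) hk hx).normal
        · rw [gb_pow_four, one_mul]
          exact Or.inr ⟨k, x, hx, rfl⟩
    · rw [← mul_assoc]
      simpa using (StartsB.step (j := 1) le_rfl (by norm_num) hk hy).normal

theorem closure_ga_gb : Subgroup.closure {ga, gb} = ⊤ := by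
  rw [← PresentedGroup.closure_range_of]
  congr 1
  ext x
  simp only [Set.mem_insert_iff, Set.mem_singleton_iff, Set.mem_range, Fin.exists_fin_two, ga, gb]
  tauto

/-- Existence of normal forms is enough; their uniqueness is never used. Since b⁻¹ = b³, left
multiplication by b and by powers of a covers all cases. -/
theorem normal_all (x : FG) : Normal x := by
  have hx : x ∈ Subgroup.closure {ga, gb} := closure_ga_gb ▸ Subgroup.mem_top x
  induction hx using Subgroup.closure_induction_left with
  | one => exact Or.inl ⟨0, by simp⟩
  | mul_left y hy z _ hz =>
    rcases hy with rfl | rfl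
    · simpa using hz.ga_zpow_mul 1
    · exact hz.gb_mul
  | inv_mul_cancel y hy z _ hz =>
    rcases hy with rfl | rfl
    · simpa using hz.ga_zpow_mul (-1)
    · rw [gb_inv, mul_assoc, mul_assoc]
      exact hz.gb_mul.gb_mul.gb_mul

/-- The homomorphism to `U(2,1)` with `a ↦ A` and `b ↦ B`. -/
noncomputable def toU : FG →* U21 :=
  PresentedGroup.toGroup (f := ![A, B]) (by
    rintro r rfl
    simpa using B_pow_four)

@[simp] theorem toU_ga : toU ga = A := by simp [toU, ga]

@[simp] theorem toU_gb : toU gb = B := by simp [toU, gb]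

/-- A word which starts with `b` does not come closer to `v` than the powers of `B`. -/
theorem StartsB.exists_horo_le {x : FG} (hx : StartsB x) :
    ∀ v : Fin 3 → ℂ, (herm v v).re < 0 →
      (∀ j : ℕ, 1 ≤ j → j ≤ 3 → horo v 1 ≤ horo v (B ^ j)) →
      ∃ j : ℕ, 1 ≤ j ∧ j ≤ 3 ∧ horo v (B ^ j) ≤ horo v (toU x) := by
  induction hx with
  | @base j k h1 h3 =>
    intro v _ _
    exact ⟨j, h1, h3, by simp [horo_mul_A_zpow]⟩
  | @step j k x h1 h3 hk _ ih =>
    intro v hv hd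
    refine ⟨j, h1, h3, ?_⟩
    have hB : ∀ g, horo (mat (B ^ j)⁻¹ *ᵥ v) g = horo v (B ^ j * g) := fun g => by
      rw [horo_mulVec, inv_inv]
    have hA : ∀ g, horo (mat (A ^ k)⁻¹ *ᵥ (mat (B ^ j)⁻¹ *ᵥ v)) g = horo v (B ^ j * (A ^ k * g)) :=
      fun g => by rw [horo_mulVec, inv_inv, hB]
    have hvB : (herm (mat (B ^ j)⁻¹ *ᵥ v) (mat (B ^ j)⁻¹ *ᵥ v)).re < 0 := by rwa [herm_mulVec]
    -- As B^j B^(4-j) = 1, the assumption on B^j says that B^(-j) v lies in the closed ball of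
    -- B^(4-j).
    have hle : horo (mat (B ^ j)⁻¹ *ᵥ v) (B ^ (4 - j)) ≤ horo (mat (B ^ j)⁻¹ *ᵥ v) 1 := by
      rw [hB, hB, ← pow_add, Nat.add_sub_cancel' (by omega), B_pow_four, mul_one]
      exact hd j h1 h3
    have h1A : horo (mat (A ^ k)⁻¹ *ᵥ (mat (B ^ j)⁻¹ *ᵥ v)) 1 = horo v (B ^ j) := by
      rw [hA, mul_one, horo_mul_A_zpow]
    -- Hence B^(-j) v is outside the translates of the balls under A^k, and A^(-k) B^(-j) v
    -- satisfies the hypothesis of the induction.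
    have hd' : ∀ i : ℕ, 1 ≤ i → i ≤ 3 →
        horo (mat (A ^ k)⁻¹ *ᵥ (mat (B ^ j)⁻¹ *ᵥ v)) 1 ≤
          horo (mat (A ^ k)⁻¹ *ᵥ (mat (B ^ j)⁻¹ *ᵥ v)) (B ^ i) := by
      intro i hi hi'
      have := horo_one_le_of_le hvB hk (by omega) (by omega) hi hi' hle
      rw [h1A, hA]
      rwa [hB, hB, mul_one] at this
    obtain ⟨i, hi, hi', h⟩ := ih _ (by rwa [herm_mulVec]) hd'
    have := (hd' i hi hi').trans h
    rw [h1A, hA, ← mul_assoc] at this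
    simpa using this

/-- The vector form of membership in `DSig`. -/
def InD (v : Fin 3 → ℂ) : Prop :=
  ∀ (k : ℤ) (j : ℕ), 1 ≤ j → j ≤ 3 → horo v 1 ≤ horo v (A ^ k * B ^ j)

/-- The vector form of membership in the interior of `DSig`. -/
def InDStrict (v : Fin 3 → ℂ) : Prop :=
  ∀ (k : ℤ) (j : ℕ), 1 ≤ j → j ≤ 3 → horo v 1 < horo v (A ^ k * B ^ j)

theorem InDStrict.inD {v : Fin 3 → ℂ} (h : InDStrict v) : InD v :=
  fun k j h1 h3 => (h k j h1 h3).le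

/-- A^(-k) fixes q∞ and permutes the defining inequalities of `InD`, so a leading power of a can be
moved onto v. -/
theorem exists_horo_le {v : Fin 3 → ℂ} (hv : (herm v v).re < 0) (h : InD v) {y : FG}
    (hy : StartsB y) (k : ℤ) :
    ∃ j : ℕ, 1 ≤ j ∧ j ≤ 3 ∧ horo v (A ^ k * B ^ j) ≤ horo v (toU (ga ^ k * y)) := by
  have hA : ∀ g, horo (mat (A ^ k)⁻¹ *ᵥ v) g = horo v (A ^ k * g) := fun g => by
    rw [horo_mulVec, inv_inv]
  obtain ⟨j, h1, h3, hj⟩ := hy.exists_horo_le (mat (A ^ k)⁻¹ *ᵥ v) (by rwa [herm_mulVec])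
    (fun j h1 h3 => by
      rw [hA, hA, mul_one, horo_A_zpow]
      exact h k j h1 h3)
  exact ⟨j, h1, h3, by simpa [hA] using hj⟩

/-- The polyhedron is a Ford domain. -/
theorem InD.horo_one_le {v : Fin 3 → ℂ} (hv : (herm v v).re < 0) (h : InD v) (x : FG) :
    horo v 1 ≤ horo v (toU x) := by
  rcases normal_all x with ⟨k, rfl⟩ | ⟨k, y, hy, rfl⟩
  · rw [map_zpow, toU_ga, horo_A_zpow]
  · obtain ⟨j, h1, h3, hj⟩ := exists_horo_le hv h hy k
    exact (h k j h1 h3).trans hj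

theorem InDStrict.horo_one_lt {v : Fin 3 → ℂ} (hv : (herm v v).re < 0) (h : InDStrict v) {x : FG}
    (hx : ∀ k : ℤ, x ≠ ga ^ k) : horo v 1 < horo v (toU x) := by
  rcases normal_all x with ⟨k, rfl⟩ | ⟨k, y, hy, rfl⟩
  · exact absurd rfl (hx k)
  · obtain ⟨j, h1, h3, hj⟩ := exists_horo_le hv h.inD hy k
    exact (h k j h1 h3).trans_le hj

/-! ## An invariant lattice and discreteness -/

/-- A lattice over the Gaussian integers which contains the orbit of `q∞`. -/
def lattice : Set (Fin 3 → ℂ) :=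
  {w | ∃ a b c d : GaussianInt, w = ![(a : ℂ) + b / 2, Complex.I * b + 2 * c, -b + 2 * d]}

/-- The imaginary unit as a Gaussian integer. -/
def gaussI : GaussianInt := ⟨0, 1⟩

theorem coe_two : ((2 : GaussianInt) : ℂ) = 2 := by
  rw [show (2 : GaussianInt) = 1 + 1 from rfl, map_add, map_one]; norm_num

theorem coe_four : ((4 : GaussianInt) : ℂ) = 4 := by
  rw [show (4 : GaussianInt) = 2 + 2 from rfl, map_add, coe_two]; norm_num

theorem gaussI_coe : (gaussI : ℂ) = Complex.I := by
  simp [gaussI, GaussianInt.toComplex_def]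

theorem A_mulVec_mem {w : Fin 3 → ℂ} (hw : w ∈ lattice) : mat A *ᵥ w ∈ lattice := by
  obtain ⟨a, b, c, d, rfl⟩ := hw
  refine ⟨a + (2 * gaussI + 2) * b + 4 * c - 4 * d, b, c + b - 2 * d, d, ?_⟩
  rw [mat_A]
  ext i
  fin_cases i <;>
    simp [Matrix.mulVec, dotProduct, Fin.sum_univ_three, gaussI_coe, coe_two, coe_four] <;> ring

theorem A_inv_mulVec_mem {w : Fin 3 → ℂ} (hw : w ∈ lattice) : mat A⁻¹ *ᵥ w ∈ lattice := by
  obtain ⟨a, b, c, d, rfl⟩ := hw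
  refine ⟨a + (2 - 2 * gaussI) * b - 4 * c - 4 * d, b, c - b + 2 * d, d, ?_⟩
  rw [mat_A_inv]
  ext i
  fin_cases i <;>
    simp [Matrix.mulVec, dotProduct, Fin.sum_univ_three, gaussI_coe, coe_two, coe_four] <;> ring

theorem B_mulVec_mem {w : Fin 3 → ℂ} (hw : w ∈ lattice) : mat B *ᵥ w ∈ lattice := by
  obtain ⟨a, b, c, d, rfl⟩ := hw
  refine ⟨gaussI * c, a - d, gaussI * d, -b + gaussI * c, ?_⟩
  rw [mat_B]
  have hI : Complex.I * Complex.I = -1 := Complex.I_mul_I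
  ext i
  fin_cases i <;>
    simp [Matrix.mulVec, dotProduct, Fin.sum_univ_three, gaussI_coe]
  · linear_combination (b / 2 : ℂ) * hI
  · ring
  · linear_combination (b : ℂ) * hI

theorem toU_mulVec_mem (x : FG) : ∀ w ∈ lattice, mat (toU x) *ᵥ w ∈ lattice := by
  have hmul : ∀ y z : FG, (∀ w ∈ lattice, mat (toU y) *ᵥ w ∈ lattice) →
      (∀ w ∈ lattice, mat (toU z) *ᵥ w ∈ lattice) →
      ∀ w ∈ lattice, mat (toU (y * z)) *ᵥ w ∈ lattice := fun y z hy hz w hw => by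
    rw [map_mul, mat_mul, ← Matrix.mulVec_mulVec]
    exact hy _ (hz _ hw)
  have hA : ∀ w ∈ lattice, mat (toU ga) *ᵥ w ∈ lattice := fun w hw => by
    rw [toU_ga]; exact A_mulVec_mem hw
  have hB : ∀ w ∈ lattice, mat (toU gb) *ᵥ w ∈ lattice := fun w hw => by
    rw [toU_gb]; exact B_mulVec_mem hw
  have hx : x ∈ Subgroup.closure {ga, gb} := closure_ga_gb ▸ Subgroup.mem_top x
  induction hx using Subgroup.closure_induction_left with
  | one => simp [mat_one]
  | mul_left y hy z _ hz =>
    rcases hy with rfl | rfl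
    · exact hmul _ _ hA hz
    · exact hmul _ _ hB hz
  | inv_mul_cancel y hy z _ hz =>
    rcases hy with rfl | rfl
    · refine hmul _ _ (fun w hw => ?_) hz
      rw [map_inv, toU_ga]
      exact A_inv_mulVec_mem hw
    · rw [gb_inv]
      exact hmul _ _ (hmul _ _ (hmul _ _ hB hB) hB) hz

/-- Complex numbers `z` with `4 * z` a Gaussian integer. -/
def IsQuarter (z : ℂ) : Prop := ∃ n : GaussianInt, 4 * z = n

theorem IsQuarter.sub {z w : ℂ} (hz : IsQuarter z) (hw : IsQuarter w) : IsQuarter (z - w) := by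
  obtain ⟨m, hm⟩ := hz
  obtain ⟨n, hn⟩ := hw
  exact ⟨m - n, by rw [mul_sub, hm, hn, map_sub]⟩

/-- The Gaussian integer 4z has an integral norm smaller than 1. -/
theorem IsQuarter.eq_zero {z : ℂ} (hz : IsQuarter z) (h : ‖z‖ < 1 / 4) : z = 0 := by
  obtain ⟨n, hn⟩ := hz
  have h1 : ‖(n : ℂ)‖ < 1 := by
    rw [← hn, norm_mul]
    norm_num
    linarith
  have h2 : (n.norm : ℝ) < 1 := by
    have := GaussianInt.intCast_real_norm n
    rw [this, Complex.normSq_eq_norm_sq]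
    nlinarith [norm_nonneg (n : ℂ)]
  have h3 : n.norm = 0 := by
    have : n.norm < 1 := by exact_mod_cast h2
    have := GaussianInt.norm_nonneg n
    omega
  have h4 := GaussianInt.intCast_real_norm n
  rw [h3, Int.cast_zero, eq_comm, Complex.normSq_eq_zero, ← hn] at h4
  simpa using h4

theorem isQuarter_half_of_mem {w : Fin 3 → ℂ} (hw : w ∈ lattice) (i : Fin 3) :
    IsQuarter (w i / 2) := by
  obtain ⟨a, b, c, d, rfl⟩ := hw
  fin_cases i
  · exact ⟨2 * a + b, by simp [coe_two]; ring⟩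
  · exact ⟨2 * gaussI * b + 4 * c, by simp [gaussI_coe, coe_two, coe_four]; ring⟩
  · exact ⟨-2 * b + 4 * d, by simp [coe_two, coe_four]; ring⟩

theorem isQuarter_of_mem {w : Fin 3 → ℂ} (hw : w ∈ lattice) (i : Fin 3) : IsQuarter (w i) := by
  obtain ⟨n, hn⟩ := isQuarter_half_of_mem hw i
  exact ⟨2 * n, by simp only [map_mul, ← hn, coe_two]; ring⟩

theorem qInf_mem_lattice : qInf ∈ lattice := ⟨1, 0, 0, 0, by simp [qInf]⟩

/-- The lattice contains twice each basis vector and its coordinates are half Gaussian integers, so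
the columns have coordinates in ¼ℤ[i]. -/
theorem isQuarter_mat_toU (x : FG) (i j : Fin 3) : IsQuarter (mat (toU x) i j) := by
  have h : (2 : ℂ) • Pi.single j 1 ∈ lattice := by
    fin_cases j
    · exact ⟨2, 0, 0, 0, by ext i; fin_cases i <;> simp [coe_two]⟩
    · exact ⟨0, 0, 1, 0, by ext i; fin_cases i <;> simp⟩
    · exact ⟨0, 0, 0, 1, by ext i; fin_cases i <;> simp⟩
  simpa [Matrix.mulVec_smul] using isQuarter_half_of_mem (toU_mulVec_mem x _ h) i

theorem finite_isQuarter (R : ℝ) : {z : ℂ | IsQuarter z ∧ ‖z‖ ≤ R}.Finite := by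
  refine Set.Finite.subset (((Set.finite_Icc (-⌈4 * R⌉) ⌈4 * R⌉).prod
    (Set.finite_Icc (-⌈4 * R⌉) ⌈4 * R⌉)).image
      (fun m : ℤ × ℤ => ((m.1 : ℂ) + m.2 * Complex.I) / 4)) ?_
  rintro z ⟨⟨n, hn⟩, hz⟩
  have h : ∀ m : ℤ, |(m : ℝ)| ≤ 4 * R → m ∈ Set.Icc (-⌈4 * R⌉) ⌈4 * R⌉ := fun m hm => by
    have h1 := abs_le.1 (hm.trans (Int.le_ceil _))
    exact ⟨by exact_mod_cast h1.1, by exact_mod_cast h1.2⟩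
  have h4 : ‖(n : ℂ)‖ ≤ 4 * R := by
    rw [← hn, norm_mul]
    norm_num
    exact hz
  refine ⟨(n.re, n.im), ⟨h _ ?_, h _ ?_⟩, ?_⟩
  · exact (by simpa using Complex.abs_re_le_norm (n : ℂ) : |(n.re : ℝ)| ≤ _).trans h4
  · exact (by simpa using Complex.abs_im_le_norm (n : ℂ) : |(n.im : ℝ)| ≤ _).trans h4
  · simp only
    rw [← GaussianInt.toComplex_def n, ← hn]
    ring

theorem finite_lattice_norm_le (R : ℝ) : {w ∈ lattice | ∀ i, ‖w i‖ ≤ R}.Finite := by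
  refine Set.Finite.subset (Set.Finite.pi' (fun _ : Fin 3 => finite_isQuarter R)) ?_
  exact fun w hw i => ⟨isQuarter_of_mem hw.1 i, hw.2 i⟩

/-- Null vectors with a small product with a negative vector are bounded. -/
theorem norm_le_of_null {v w : Fin 3 → ℂ} {u r M : ℝ} (hv2 : v 2 = 1) (hu : 0 < u)
    (hvu : (herm v v).re ≤ -u) (hM : ∀ i, ‖v i‖ ≤ M) (hr : 0 ≤ r)
    (hw : (herm w w).re = 0) (h : ‖herm v w‖ ≤ r) (i : Fin 3) :
    ‖w i‖ ≤ r + (2 * r / u + r + 2 * r / u * M) * (1 + M) := by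
  have hM0 : 0 ≤ M := (norm_nonneg _).trans (hM 0)
  -- The left side is nonnegative and the last term is at most -u|w₂|²; this bounds w₂, then w₁, and
  -- then w₀ through the formula for ⟨v, w⟩.
  have key : Complex.normSq (w 1 - w 2 * v 1) =
      -2 * (w 2 * herm v w).re + Complex.normSq (w 2) * (herm v v).re := by
    rw [herm_self_re] at *
    rw [herm_apply]
    simp [hv2, Complex.normSq_apply] at *
    linear_combination hw
  have hre : -(w 2 * herm v w).re ≤ ‖w 2‖ * r := by
    refine (neg_le_abs _).trans ((Complex.abs_re_le_norm _).trans ?_)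
    rw [norm_mul]
    gcongr
  rw [Complex.normSq_eq_norm_sq, Complex.normSq_eq_norm_sq] at key
  have h2 : ‖w 2‖ ≤ 2 * r / u := by
    rw [le_div_iff₀ hu]
    rcases (norm_nonneg (w 2)).eq_or_lt with h0 | h0
    · rw [← h0]; linarith
    · have : ‖w 2‖ * (‖w 2‖ * u) ≤ ‖w 2‖ * (2 * r) := by
        nlinarith [sq_nonneg ‖w 1 - w 2 * v 1‖, sq_nonneg ‖w 2‖]
      exact le_of_mul_le_mul_left this h0
  set C := 2 * r / u with hC
  have hC0 : 0 ≤ C := by positivity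
  have h1' : ‖w 1 - w 2 * v 1‖ ≤ C + r := by
    refine (sq_le_sq₀ (norm_nonneg _) (by positivity)).1 ?_
    have : ‖w 2‖ * r ≤ C * r := by gcongr
    nlinarith [sq_nonneg ‖w 2‖]
  have h1 : ‖w 1‖ ≤ C + r + C * M := by
    calc ‖w 1‖ = ‖(w 1 - w 2 * v 1) + w 2 * v 1‖ := by ring_nf
      _ ≤ ‖w 1 - w 2 * v 1‖ + ‖w 2‖ * ‖v 1‖ := by rw [← norm_mul]; exact norm_add_le _ _
      _ ≤ C + r + C * M := by gcongr; exact hM 1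
  have h0 : ‖w 0‖ ≤ r + (C + r + C * M) * M + C * M := by
    have e : star (w 0) = herm v w - star (w 1) * v 1 - star (w 2) * v 0 := by
      rw [herm_apply, hv2]; ring
    calc ‖w 0‖ = ‖herm v w - star (w 1) * v 1 - star (w 2) * v 0‖ := by rw [← e, norm_star]
      _ ≤ ‖herm v w‖ + ‖w 1‖ * ‖v 1‖ + ‖w 2‖ * ‖v 0‖ := by
        refine (norm_sub_le _ _).trans ?_
        rw [norm_mul, norm_star]
        gcongr
        refine (norm_sub_le _ _).trans ?_
        rw [norm_mul, norm_star]
      _ ≤ _ := by gcongr <;> exact hM _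
  have hCM : 0 ≤ C * M := by positivity
  have hCM' : 0 ≤ (C + r + C * M) * M := by positivity
  fin_cases i
  · exact h0.trans (by linarith)
  · exact h1.trans (by linarith)
  · exact h2.trans (by linarith)

/-- The orbit points which come close to some vector of a bounded set form a finite set. -/
theorem finite_orbit {u r M : ℝ} (hu : 0 < u) (hr : 0 ≤ r) :
    {w : Fin 3 → ℂ | ∃ x : FG, w = mat (toU x) *ᵥ qInf ∧ ∃ v : Fin 3 → ℂ, v 2 = 1 ∧
      (herm v v).re ≤ -u ∧ (∀ i, ‖v i‖ ≤ M) ∧ ‖herm v w‖ ≤ r}.Finite := by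
  refine (finite_lattice_norm_le (r + (2 * r / u + r + 2 * r / u * M) * (1 + M))).subset ?_
  rintro w ⟨x, rfl, v, hv2, hvu, hM, h⟩
  refine ⟨toU_mulVec_mem x _ qInf_mem_lattice,
    norm_le_of_null hv2 hu hvu hM hr ?_ h⟩
  rw [herm_mulVec]
  simp [herm_apply, qInf]

/-- For each negative vector, some group element minimises the horospherical function. -/
theorem exists_horo_min {v : Fin 3 → ℂ} (hv : (herm v v).re < 0) :
    ∃ x : FG, ∀ y : FG, horo v (toU x) ≤ horo v (toU y) := by
  have hpos : 0 < ‖(v 2)⁻¹‖ := norm_pos_iff.2 (inv_ne_zero (apply_two_ne_zero hv))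
  suffices h : ∃ x : FG, ∀ y : FG, horo (normalize v) (toU x) ≤ horo (normalize v) (toU y) by
    obtain ⟨x, hx⟩ := h
    refine ⟨x, fun y => le_of_mul_le_mul_left ?_ hpos⟩
    rw [← horo_smul, ← horo_smul]
    exact hx y
  have hn2 := normalize_two hv
  have hn := normalize_neg hv
  set w := normalize v
  -- The identity has value 1 at the normalized vector, so only orbit points with value at most 1
  -- compete for the minimum.
  have hfin : {w' : Fin 3 → ℂ | (∃ x : FG, w' = mat (toU x) *ᵥ qInf) ∧ ‖herm w w'‖ ≤ 1}.Finite := by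
    refine (finite_orbit (u := -(herm w w).re) (r := 1) (M := ∑ i, ‖w i‖) (by linarith)
      zero_le_one).subset ?_
    rintro w' ⟨⟨x, hx⟩, h⟩
    exact ⟨x, hx, w, hn2, by simp, fun i => Finset.single_le_sum (f := fun i => ‖w i‖)
      (fun i _ => norm_nonneg _) (Finset.mem_univ i), h⟩
  have hmem : ∀ x : FG, horo w (toU x) ≤ 1 → mat (toU x) *ᵥ qInf ∈
      {w' : Fin 3 → ℂ | (∃ x : FG, w' = mat (toU x) *ᵥ qInf) ∧ ‖herm w w'‖ ≤ 1} :=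
    fun x hx => ⟨⟨x, rfl⟩, hx⟩
  have h1 : horo w (toU 1) = 1 := by rw [map_one, horo_one, hn2, norm_one]
  obtain ⟨_, ⟨⟨x, rfl⟩, -⟩, hmin⟩ :=
    Set.exists_min_image _ (fun w' => ‖herm w w'‖) hfin ⟨_, hmem 1 h1.le⟩
  refine ⟨x, fun y => ?_⟩
  rcases le_total (horo w (toU y)) 1 with hy | hy
  · exact hmin _ (hmem y hy)
  · exact ((hmin _ (hmem 1 h1.le)).trans h1.le).trans hy

/-! ## Elements near the scalars -/

theorem norm_eq_one_of_scalar {g : U21} {c : ℂ} (h : mat g = c • (1 : Matrix (Fin 3) (Fin 3) ℂ)) :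
    ‖c‖ = 1 := by
  have h1 := herm_mulVec g ![0, 1, 0] ![0, 1, 0]
  rw [h] at h1
  simp [herm_apply, Matrix.smul_mulVec, ← Complex.normSq_eq_conj_mul_self] at h1
  have h2 : Complex.normSq c = 1 := by exact_mod_cast h1
  rw [Complex.normSq_eq_norm_sq] at h2
  exact (pow_eq_one_iff_of_nonneg (norm_nonneg _) two_ne_zero).1 h2

/-- Two diagonal entries each within 1/8 of 1, up to the common unit c, differ by less than 1/4, the
minimal distance between distinct elements of ¼ℤ[i]. Allowing c is what makes this usable in the
quotient. -/
theorem toU_mem_scalars_of_near {x : FG} {c : ℂ} (hc : ‖c‖ = 1)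
    (h : ∀ i j, ‖c * mat (toU x) i j - (1 : Matrix (Fin 3) (Fin 3) ℂ) i j‖ < 1 / 8) :
    toU x ∈ scalars := by
  refine ⟨mat (toU x) 0 0, ?_⟩
  ext i j
  by_cases hij : i = j
  · subst hij
    have h1 := h i i
    have h0 := h 0 0
    rw [Matrix.one_apply_eq] at h0 h1
    have := ((isQuarter_mat_toU x i i).sub (isQuarter_mat_toU x 0 0)).eq_zero (by
      calc ‖mat (toU x) i i - mat (toU x) 0 0‖
          = ‖c * (mat (toU x) i i - mat (toU x) 0 0)‖ := by rw [norm_mul, hc, one_mul]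
        _ = ‖(c * mat (toU x) i i - 1) - (c * mat (toU x) 0 0 - 1)‖ := by ring_nf
        _ < 1 / 4 := (norm_sub_le _ _).trans_lt (by linarith))
    simpa [sub_eq_zero] using this
  · have h1 := h i j
    rw [Matrix.one_apply_ne hij, sub_zero, norm_mul, hc, one_mul] at h1
    rw [(isQuarter_mat_toU x i j).eq_zero (by linarith)]
    simp [Matrix.one_apply_ne hij]

open Topology Filter

/-! ## Lifts of points of the complex hyperbolic plane -/

/-- The point of the complex hyperbolic plane with a given negative lift. -/
noncomputable def ofVec (v : Fin 3 → ℂ) (hv : (herm v v).re < 0) : H2C :=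
  ⟨Projectivization.mk ℂ v (ne_zero_of_neg hv), (neg_mk_iff v _).2 hv⟩

/-- The lift with last coordinate `1`. -/
noncomputable def lift (p : H2C) : Fin 3 → ℂ := normalize p.1.rep

theorem lift_two (p : H2C) : lift p 2 = 1 := normalize_two p.2

theorem lift_neg (p : H2C) : (herm (lift p) (lift p)).re < 0 := normalize_neg p.2

theorem ofVec_eq_ofVec {v w : Fin 3 → ℂ} {hv : (herm v v).re < 0} {hw : (herm w w).re < 0} :
    ofVec v hv = ofVec w hw ↔ ∃ c : ℂ, c • w = v := by
  rw [ofVec, ofVec, Subtype.mk.injEq, Projectivization.mk_eq_mk_iff']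

theorem ofVec_rep (p : H2C) : ofVec p.1.rep p.2 = p := Subtype.ext p.1.mk_rep

theorem ofVec_lift (p : H2C) : ofVec (lift p) (lift_neg p) = p := by
  conv_rhs => rw [← ofVec_rep p]
  exact ofVec_eq_ofVec.2 ⟨_, rfl⟩

theorem normalize_smul {c : ℂ} (hc : c ≠ 0) (v : Fin 3 → ℂ) : normalize (c • v) = normalize v := by
  simp only [normalize, Pi.smul_apply, smul_eq_mul, smul_smul]
  congr 1
  rw [mul_inv, mul_comm c⁻¹, inv_mul_cancel_right₀ hc]

theorem lift_ofVec (v : Fin 3 → ℂ) (hv : (herm v v).re < 0) : lift (ofVec v hv) = normalize v := by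
  obtain ⟨c, hc⟩ := ofVec_eq_ofVec.1 (ofVec_rep (ofVec v hv))
  have hc0 : c ≠ 0 := by
    rintro rfl
    rw [zero_smul] at hc
    exact (ofVec v hv).1.rep_nonzero hc.symm
  rw [lift, ← hc, normalize_smul hc0]

theorem normalize_of_two {v : Fin 3 → ℂ} (hv : v 2 = 1) : normalize v = v := by
  simp [normalize, hv]

theorem smul_ofVec (g : U21) (v : Fin 3 → ℂ) (hv : (herm v v).re < 0) :
    (QuotientGroup.mk g : PU21) • ofVec v hv = ofVec (mat g *ᵥ v) (by rwa [herm_mulVec]) := rfl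

theorem continuous_herm_self : Continuous fun v : Fin 3 → ℂ => (herm v v).re := by
  simp only [herm_apply]
  fun_prop

theorem continuous_ofVec :
    Continuous fun v : {v : Fin 3 → ℂ // (herm v v).re < 0} => ofVec v.1 v.2 := by
  refine Continuous.subtype_mk ?_ _
  have h : Continuous fun v : {v : Fin 3 → ℂ // v ≠ 0} => (Projectivization.mk ℂ v.1 v.2 : CP2) :=
    continuous_quot_mk
  exact h.comp (Continuous.subtype_mk continuous_subtype_val fun v => ne_zero_of_neg v.2)

/-- Normalizing removes the arbitrary choice of representative. The projection from nonzero vectors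
is still a quotient map over the open set of negative lines, so continuity can be tested on vectors.
-/
theorem continuous_lift : Continuous lift := by
  let π : {v : Fin 3 → ℂ // v ≠ 0} → CP2 := fun v => Projectivization.mk ℂ v.1 v.2
  have hπ : IsQuotientMap π := isQuotientMap_quot_mk
  have hopen : IsOpen {p : CP2 | (herm p.rep p.rep).re < 0} := by
    rw [← hπ.isOpen_preimage]
    have : π ⁻¹' {p : CP2 | (herm p.rep p.rep).re < 0} =
        {v | (herm v.1 v.1).re < 0} := Set.ext fun v => neg_mk_iff v.1 v.2
    rw [this]
    exact isOpen_Iio.preimage (continuous_herm_self.comp continuous_subtype_val)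
  refine (hπ.restrictPreimage_isOpen hopen).continuous_iff.2 ?_
  have hneg : ∀ v : π ⁻¹' {p : CP2 | (herm p.rep p.rep).re < 0},
      (herm v.1.1 v.1.1).re < 0 := fun v => (neg_mk_iff v.1.1 v.1.2).1 v.2
  have e : lift ∘ Set.restrictPreimage {p : CP2 | (herm p.rep p.rep).re < 0} π =
      fun v => (v.1.1 2)⁻¹ • v.1.1 := funext fun v => lift_ofVec v.1.1 (hneg v)
  rw [e]
  have h2 : Continuous fun v : π ⁻¹' {p : CP2 | (herm p.rep p.rep).re < 0} => v.1.1 2 :=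
    (continuous_apply 2).comp (continuous_subtype_val.comp continuous_subtype_val)
  exact (h2.inv₀ fun v => apply_two_ne_zero (hneg v)).smul
    (continuous_subtype_val.comp continuous_subtype_val)

theorem continuous_horo_lift (g : U21) : Continuous fun p => horo (lift p) g := by
  have : Continuous fun v : Fin 3 → ℂ => horo v g := by
    simp only [horo, herm_apply]
    fun_prop
  exact this.comp continuous_lift

theorem horo_lift_one (p : H2C) : horo (lift p) 1 = 1 := by rw [horo_one, lift_two, norm_one]

/-! ## The polyhedron and its interior -/

theorem mem_closedExterior_ofVec (g : U21) (v : Fin 3 → ℂ) (hv : (herm v v).re < 0) :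
    ofVec v hv ∈ closedExterior g ↔ horo v 1 ≤ horo v g⁻¹ := by
  rw [mem_closedExterior_iff g _ v (ne_zero_of_neg hv) rfl, horo, horo, mat_one, Matrix.one_mulVec]

/-- An exterior involves g⁻¹ q∞, and the right factor A^(-k) fixes q∞. The conjugates of B, B⁻¹, B²
therefore give j = 3, 1, 2. -/
theorem ofVec_mem_DSig {v : Fin 3 → ℂ} (hv : (herm v v).re < 0) : ofVec v hv ∈ DSig ↔ InD v := by
  have e : ∀ (k : ℤ) (g : U21), horo v (A ^ k * g * A ^ (-k))⁻¹ = horo v (A ^ k * g⁻¹) := fun k g => by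
    rw [← horo_mul_A_zpow v (A ^ k * g⁻¹) (-k)]
    congr 1
    group
  have e1 : B⁻¹ = B ^ 3 := inv_eq_of_mul_eq_one_right (by rw [← pow_succ', B_pow_four])
  have e2 : (B ^ 2)⁻¹ = B ^ 2 := inv_eq_of_mul_eq_one_right (by rw [← pow_add, B_pow_four])
  simp only [DSig, Set.mem_iInter, Set.mem_inter_iff, mem_closedExterior_ofVec, e, e2, inv_inv]
  rw [e1]
  constructor
  · intro h k j h1 h3
    obtain ⟨⟨ha, hb⟩, hc⟩ := h k
    interval_cases j
    · rwa [pow_one]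
    · exact hc
    · exact ha
  · intro h k
    exact ⟨⟨h k 3 (by norm_num) le_rfl, by simpa using h k 1 le_rfl (by norm_num)⟩,
      h k 2 (by norm_num) (by norm_num)⟩

theorem mem_DSig (p : H2C) : p ∈ DSig ↔ InD (lift p) := by
  conv_lhs => rw [← ofVec_lift p]
  exact ofVec_mem_DSig _

theorem isClosed_DSig : IsClosed DSig := by
  have : DSig = ⋂ (k : ℤ) (j : ℕ) (_ : 1 ≤ j) (_ : j ≤ 3),
      {p | horo (lift p) 1 ≤ horo (lift p) (A ^ k * B ^ j)} := by
    ext p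
    simp [mem_DSig, InD]
  rw [this]
  exact isClosed_iInter fun k => isClosed_iInter fun j => isClosed_iInter fun _ =>
    isClosed_iInter fun _ => isClosed_le (continuous_horo_lift _) (continuous_horo_lift _)

/-- The points of the polyhedron which lie on no face. -/
def DInt : Set H2C := {p | InDStrict (lift p)}

theorem DInt_subset : DInt ⊆ DSig := fun p hp => (mem_DSig p).2 (InDStrict.inD hp)

/-- The modulus is at least minus the real part, which is computed by `herm_re_of_null`, and the
weight is at least 1. The bound discards spheres that are far away horizontally or far below. -/
theorem le_horo {v : Fin 3 → ℂ} (hv : v 2 = 1) (k : ℤ) {j : ℕ}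
    (h1 : 1 ≤ j) (h3 : j ≤ 3) :
    (Complex.normSq (v 1 - cusp k (j - 2) 1) - (herm v v).re) / 2 ≤ horo v (A ^ k * B ^ j) := by
  have h := herm_re_of_null hv (cusp_two k (j - 2)) (herm_cusp_self _ _)
  have ha := (neg_le_abs _).trans (Complex.abs_re_le_norm (herm v (cusp k (j - 2))))
  rw [horo_eq v k h1 h3]
  nlinarith [norm_nonneg (herm v (cusp k (j - 2))), one_le_weight (j - 2)]

theorem one_lt_horo {v : Fin 3 → ℂ} (hv : v 2 = 1) (hv0 : (herm v v).re < 0) {k : ℤ} {j : ℕ}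
    (h1 : 1 ≤ j) (h3 : j ≤ 3) (hk : ‖v 1‖ + 2 ≤ 2 * |(k : ℝ)|) : 1 < horo v (A ^ k * B ^ j) := by
  refine lt_of_lt_of_le ?_ (le_horo hv k h1 h3)
  have hre : (v 1 - cusp k (j - 2) 1).re = (v 1).re + 2 * k := by simp [cusp]
  have h4 : 2 ≤ |(v 1 - cusp k (j - 2) 1).re| := by
    rw [hre]
    have a1 := Complex.abs_re_le_norm (v 1)
    have a2 := abs_sub_abs_le_abs_sub (2 * (k : ℝ)) (-(v 1).re)
    rw [abs_neg, sub_neg_eq_add, abs_mul, add_comm (2 * (k : ℝ))] at a2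
    norm_num at a2
    linarith
  rw [Complex.normSq_apply]
  nlinarith [sq_abs (v 1 - cusp k (j - 2) 1).re, mul_self_nonneg (v 1 - cusp k (j - 2) 1).im]

/-- Near a given point, all but finitely many of the strict inequalities hold automatically, since
the centres for k have horizontal real part -2k. -/
theorem isOpen_DInt : IsOpen DInt := by
  rw [isOpen_iff_mem_nhds]
  intro p hp
  obtain ⟨N, hN⟩ := exists_nat_gt ((‖lift p 1‖ + 2) / 2)
  have hcont : Continuous fun q : H2C => (‖lift q 1‖ + 2) / 2 :=
    ((((continuous_apply 1).comp continuous_lift).norm).add continuous_const).div_const 2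
  have hfar : ∀ᶠ q in 𝓝 p, (‖lift q 1‖ + 2) / 2 < N := hcont.continuousAt.eventually_lt
    continuousAt_const hN
  have hnear : ∀ᶠ q in 𝓝 p, ∀ k ∈ Set.Icc (-(N : ℤ)) N, ∀ j ∈ Set.Icc 1 3,
      1 < horo (lift q) (A ^ k * B ^ j) := by
    rw [eventually_all_finite (Set.finite_Icc _ _)]
    intro k _
    rw [eventually_all_finite (Set.finite_Icc _ _)]
    intro j hj
    refine (continuous_horo_lift _).continuousAt.eventually_const_lt ?_
    rw [← horo_lift_one p]
    exact hp k j hj.1 hj.2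
  filter_upwards [hfar, hnear] with q hq hq' k j h1 h3
  rw [horo_lift_one]
  by_cases hk : k ∈ Set.Icc (-(N : ℤ)) N
  · exact hq' k hk j ⟨h1, h3⟩
  · refine one_lt_horo (lift_two q) (lift_neg q) h1 h3 ?_
    have : (N : ℤ) ≤ |k| := by
      by_contra! h
      exact hk (abs_le.1 h.le)
    have : (N : ℝ) ≤ |(k : ℝ)| := by exact_mod_cast this
    linarith

/-! ## The vertical flow -/

/-- The vertical flow on lifts. -/
noncomputable def flowVec (t : ℝ) (v : Fin 3 → ℂ) : Fin 3 → ℂ :=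
  v + (((Real.exp t - 1) * (herm v v).re / 2 : ℝ) : ℂ) • qInf

theorem flowVec_two (t : ℝ) (v : Fin 3 → ℂ) : flowVec t v 2 = v 2 := by simp [flowVec, qInf]

/-- Adding a real r to v₀ changes ⟨v, v⟩ by 2r; the coefficient in `flowVec` is chosen to produce
the factor e^t, which gives a one-parameter group. -/
theorem herm_flowVec_self (t : ℝ) {v : Fin 3 → ℂ} (hv : v 2 = 1) :
    (herm (flowVec t v) (flowVec t v)).re = Real.exp t * (herm v v).re := by
  rw [herm_self_re (flowVec t v), flowVec_two, hv]
  have h := herm_self_re v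
  rw [hv] at h
  simp [flowVec, qInf, Complex.exp_ofReal_re] at h ⊢
  linear_combination -h

theorem flowVec_neg (t : ℝ) (p : H2C) :
    (herm (flowVec t (lift p)) (flowVec t (lift p))).re < 0 := by
  rw [herm_flowVec_self t (lift_two p)]
  exact mul_neg_of_pos_of_neg (Real.exp_pos t) (lift_neg p)

/-- The vertical flow on the complex hyperbolic plane. -/
noncomputable def flow (t : ℝ) (p : H2C) : H2C := ofVec (flowVec t (lift p)) (flowVec_neg t p)

theorem lift_flow (t : ℝ) (p : H2C) : lift (flow t p) = flowVec t (lift p) := by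
  rw [flow, lift_ofVec, normalize_of_two]
  rw [flowVec_two, lift_two]

theorem flow_flow (s t : ℝ) (p : H2C) : flow s (flow t p) = flow (s + t) p := by
  rw [← ofVec_lift (flow s (flow t p)), ← ofVec_lift (flow (s + t) p)]
  refine ofVec_eq_ofVec.2 ⟨1, ?_⟩
  rw [lift_flow, lift_flow, lift_flow, one_smul, flowVec, flowVec,
    herm_flowVec_self t (lift_two p), flowVec, add_assoc, ← add_smul, Real.exp_add]
  congr 2
  push_cast
  ring

theorem flow_zero (p : H2C) : flow 0 p = p := by
  conv_rhs => rw [← ofVec_lift p]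
  exact ofVec_eq_ofVec.2 ⟨1, by simp [flowVec]⟩

theorem continuous_flow (p : H2C) : Continuous fun t => flow t p := by
  refine continuous_ofVec.comp (f := fun t : ℝ => ⟨flowVec t (lift p), flowVec_neg t p⟩)
    (Continuous.subtype_mk ?_ _)
  unfold flowVec
  fun_prop

/-- The flow adds a negative real number to ⟨v, w⟩, whose real part is already negative. The modulus
grows strictly, while the comparison value stays 1. -/
theorem flow_mem_DInt {p : H2C} (hp : p ∈ DSig) {t : ℝ} (ht : 0 < t) : flow t p ∈ DInt := by
  intro k j h1 h3
  rw [horo_lift_one, lift_flow, horo_eq _ k h1 h3]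
  have h := (mem_DSig p).1 hp k j h1 h3
  rw [horo_lift_one, horo_eq _ k h1 h3] at h
  refine h.trans_lt (mul_lt_mul_of_pos_left ?_ (zero_lt_one.trans_le (one_le_weight _)))
  have hre := herm_re_of_null (lift_two p) (cusp_two k (j - 2)) (herm_cusp_self _ _)
  set w := cusp k (j - 2) with hw
  have e : herm (flowVec t (lift p)) w = herm (lift p) w +
      (((Real.exp t - 1) * (herm (lift p) (lift p)).re / 2 : ℝ) : ℂ) := by
    rw [herm_apply, herm_apply, flowVec_two]
    simp [flowVec, qInf, hw, cusp_two]
    ring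
  have hneg : (Real.exp t - 1) * (herm (lift p) (lift p)).re / 2 < 0 := by
    have := Real.one_lt_exp_iff.2 ht
    have := mul_neg_of_pos_of_neg (sub_pos.2 this) (lift_neg p)
    linarith
  rw [e, ← sq_lt_sq₀ (norm_nonneg _) (norm_nonneg _), ← Complex.normSq_eq_norm_sq,
    ← Complex.normSq_eq_norm_sq, Complex.normSq_apply, Complex.normSq_apply]
  simp only [Complex.add_re, Complex.add_im, Complex.ofReal_re, Complex.ofReal_im, add_zero]
  have := Complex.normSq_nonneg (lift p 1 - w 1)
  have := lift_neg p
  nlinarith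

/-- An interior point can be flowed backwards a little inside D_Σ; flowing forwards again lands it
in `DInt`. -/
theorem interior_DSig : interior DSig = DInt := by
  refine Set.Subset.antisymm (fun p hp => ?_) (interior_maximal DInt_subset isOpen_DInt)
  have h0 : Tendsto (fun t => flow (-t) p) (𝓝[>] 0) (𝓝 p) := by
    have := ((continuous_flow p).comp continuous_neg).tendsto 0
    simp only [Function.comp_apply, neg_zero, flow_zero] at this
    exact this.mono_left nhdsWithin_le_nhds
  obtain ⟨t, ht, ht0⟩ := ((h0.eventually (mem_interior_iff_mem_nhds.1 hp)).and
    self_mem_nhdsWithin).exists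
  have := flow_mem_DInt ht ht0
  rwa [flow_flow, add_neg_cancel, flow_zero] at this

theorem closure_interior_DSig : closure (interior DSig) = DSig := by
  refine Set.Subset.antisymm (closure_minimal interior_subset isClosed_DSig) fun p hp => ?_
  have h0 : Tendsto (fun t => flow t p) (𝓝[>] 0) (𝓝 p) := by
    have := (continuous_flow p).tendsto 0
    rw [flow_zero] at this
    exact this.mono_left nhdsWithin_le_nhds
  refine mem_closure_of_tendsto h0 ?_
  rw [interior_DSig]
  filter_upwards [self_mem_nhdsWithin] with t ht using flow_mem_DInt hp ht

/-- A horoball at `q∞`. -/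
def horoball : Set H2C := {p | (herm (lift p) (lift p)).re < -2}

theorem horoball_subset : horoball ⊆ DInt := by
  intro p hp k j h1 h3
  rw [horo_lift_one]
  refine lt_of_lt_of_le ?_ (le_horo (lift_two p) k h1 h3)
  have : (herm (lift p) (lift p)).re < -2 := hp
  have := Complex.normSq_nonneg (lift p 1 - cusp k (j - 2) 1)
  linarith

/-- In coordinates with last entry 1 the horoball is convex. -/
theorem isPreconnected_horoball : IsPreconnected horoball := by
  let C : Set (Fin 3 → ℂ) := {v | v 2 = 1 ∧ 2 * (v 0).re + ‖v 1‖ ^ 2 < -2}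
  have hC : Convex ℝ C := by
    have h1 : Convex ℝ {v : Fin 3 → ℂ | v 2 = 1} := by
      intro v hv w hw a b ha hb hab
      simp only [Set.mem_ofPred_eq, Pi.add_apply, Pi.smul_apply] at *
      rw [hv, hw, ← add_smul, hab, one_smul]
    have h2 : ConvexOn ℝ Set.univ fun v : Fin 3 → ℂ => 2 * (v 0).re + ‖v 1‖ ^ 2 := by
      refine ConvexOn.add ?_ ?_
      · refine ⟨convex_univ, fun v _ w _ a b _ _ _ => le_of_eq ?_⟩
        simp
        ring
      · have h3 : ConvexOn ℝ Set.univ fun v : Fin 3 → ℂ => ‖v 1‖ :=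
          (convexOn_norm convex_univ).comp_linearMap (LinearMap.proj (R := ℝ) (φ := fun _ => ℂ) 1)
        exact h3.pow (fun v _ => norm_nonneg _) 2
    have h4 := h2.convex_lt (-2)
    simp only [Set.mem_univ, true_and] at h4
    exact h1.inter h4
  have hself : ∀ v : Fin 3 → ℂ, v 2 = 1 →
      (herm v v).re = 2 * (v 0).re + ‖v 1‖ ^ 2 := fun v hv => by
    rw [herm_self_re, hv, Complex.normSq_eq_norm_sq]; simp
  have hneg : ∀ v ∈ C, (herm v v).re < 0 := fun v hv => by
    rw [hself v hv.1]; linarith [hv.2]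
  have hr : horoball = Set.range fun v : C => ofVec v.1 (hneg v.1 v.2) := by
    ext p
    constructor
    · intro hp
      refine ⟨⟨lift p, lift_two p, ?_⟩, ofVec_lift p⟩
      rw [← hself _ (lift_two p)]
      exact hp
    · rintro ⟨v, rfl⟩
      change (herm (lift (ofVec v.1 _)) (lift (ofVec v.1 _))).re < -2
      rw [lift_ofVec, normalize_of_two v.2.1, hself _ v.2.1]
      exact v.2.2
  have := Subtype.preconnectedSpace hC.isPreconnected
  rw [hr]
  refine isPreconnected_range ?_
  exact continuous_ofVec.comp (f := fun v : C => ⟨v.1, hneg v.1 v.2⟩)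
    (Continuous.subtype_mk continuous_subtype_val _)

theorem flow_mem_horoball (p : H2C) : ∃ t : ℝ, 0 ≤ t ∧ flow t p ∈ horoball := by
  have hs := lift_neg p
  -- With s = -⟨v, v⟩ and t = 2/s, the estimate e^t ≥ 1 + t gives s e^t ≥ s + 2 > 2.
  refine ⟨2 / -(herm (lift p) (lift p)).re, by apply div_nonneg <;> linarith, ?_⟩
  change (herm (lift (flow _ p)) (lift (flow _ p))).re < -2
  rw [lift_flow, herm_flowVec_self _ (lift_two p)]
  have h := Real.add_one_le_exp (2 / -(herm (lift p) (lift p)).re)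
  have h2 : 2 / -(herm (lift p) (lift p)).re * -(herm (lift p) (lift p)).re = 2 :=
    div_mul_cancel₀ _ (by linarith)
  nlinarith

/-- Flow lines join every point to the horoball without leaving `DInt`. -/
theorem isConnected_DInt : IsConnected DInt := by
  have hv : (herm ![-2, 0, 1] ![-2, 0, 1]).re < 0 := by
    rw [herm_self_re]; simp
  obtain ⟨t₀, -, h₀⟩ := flow_mem_horoball (ofVec ![-2, 0, 1] hv)
  refine ⟨⟨_, horoball_subset h₀⟩, isPreconnected_of_forall (flow t₀ (ofVec ![-2, 0, 1] hv)) fun p hp => ?_⟩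
  obtain ⟨t, ht, htp⟩ := flow_mem_horoball p
  refine ⟨horoball ∪ (fun s => flow s p) '' Set.Icc 0 t, ?_, Or.inl h₀,
    Or.inr ⟨0, ⟨le_rfl, ht⟩, flow_zero p⟩, ?_⟩
  · refine Set.union_subset horoball_subset ?_
    rintro _ ⟨s, ⟨hs, -⟩, rfl⟩
    rcases hs.eq_or_lt with rfl | hs
    · simpa only [flow_zero] using hp
    · exact flow_mem_DInt (DInt_subset hp) hs
  · exact IsPreconnected.union (flow t p) htp ⟨t, ⟨ht, le_rfl⟩, rfl⟩ isPreconnected_horoball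
      (isPreconnected_Icc.image _ (continuous_flow p).continuousOn)

/-! ## The group -/

/-- The homomorphism to `PU(2,1)` with `a ↦ A` and `b ↦ B`. -/
noncomputable def toPU : FG →* PU21 := (QuotientGroup.mk' scalars).comp toU

theorem toPU_apply (x : FG) : toPU x = QuotientGroup.mk (toU x) := rfl

theorem toPU_ga : toPU ga = pA := by rw [toPU_apply, toU_ga, pA]

theorem toPU_gb : toPU gb = pB := by rw [toPU_apply, toU_gb, pB]

theorem range_toPU : toPU.range = Sig := by
  rw [MonoidHom.range_eq_map, ← closure_ga_gb, MonoidHom.map_closure, Set.image_pair, toPU_ga,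
    toPU_gb, Sig]

theorem exists_toPU {g : PU21} (hg : g ∈ Sig) : ∃ x : FG, toPU x = g := by
  rwa [← range_toPU] at hg

theorem toPU_mem (x : FG) : toPU x ∈ Sig := range_toPU ▸ ⟨x, rfl⟩

theorem horo_of_mem_scalars {g : U21} (hg : g ∈ scalars) (v : Fin 3 → ℂ) :
    horo v g = horo v 1 := by
  obtain ⟨c, hc⟩ := hg
  have : herm v (c • qInf) = star c * herm v qInf := by simp [herm_apply]; ring
  rw [horo, hc, Matrix.smul_mulVec, Matrix.one_mulVec, this, norm_mul, norm_star,
    norm_eq_one_of_scalar hc, one_mul, horo, mat_one, Matrix.one_mulVec]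

/-- A scalar leaves `horo` unchanged, which contradicts the strict inequality at an interior point
unless x is a power of a; a nonzero power of A has a nonzero off-diagonal entry. -/
theorem toPU_injective : Function.Injective toPU := by
  rw [injective_iff_map_eq_one]
  intro x hx
  have hs : toU x ∈ scalars := (QuotientGroup.eq_one_iff _).1 hx
  obtain ⟨p, hp⟩ := isConnected_DInt.nonempty
  by_cases h : ∃ k : ℤ, x = ga ^ k
  · obtain ⟨k, rfl⟩ := h
    obtain ⟨c, hc⟩ := hs
    rw [map_zpow, toU_ga, mat_A_zpow] at hc
    have := congrFun (congrFun hc 0) 1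
    have hk : k = 0 := by simpa using this
    rw [hk, zpow_zero]
  · have := InDStrict.horo_one_lt (lift_neg p) hp (x := x) (by simpa using h)
    exact absurd (horo_of_mem_scalars hs (lift p)).symm this.ne

theorem discreteTopology_Sig : DiscreteTopology Sig := by
  rw [discreteTopology_iff_isOpen_singleton_one]
  let O : Set U21 := {g | ∀ i j, ‖mat g i j - (1 : Matrix (Fin 3) (Fin 3) ℂ) i j‖ < 1 / 8}
  have hO : IsOpen O := by
    have : O = ⋂ (i) (j), {g | ‖mat g i j - (1 : Matrix (Fin 3) (Fin 3) ℂ) i j‖ < 1 / 8} := by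
      ext g; simp [O]
    rw [this]
    have hc : Continuous mat := Units.continuous_val.comp continuous_subtype_val
    exact isOpen_iInter_of_finite fun i => isOpen_iInter_of_finite fun j =>
      isOpen_lt ((hc.matrix_elem i j).sub continuous_const).norm continuous_const
  refine ⟨(QuotientGroup.mk : U21 → PU21) '' O, QuotientGroup.isOpenMap_coe O hO, ?_⟩
  ext g
  rw [Set.mem_preimage, Set.mem_singleton_iff]
  constructor
  · rintro ⟨h, hh, hg⟩
    obtain ⟨x, hx⟩ := exists_toPU g.2
    rw [← hx, toPU_apply, eq_comm, QuotientGroup.eq] at hg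
    obtain ⟨c, hc⟩ := hg
    have hm : mat h = c • mat (toU x) := by
      have : h = toU x * ((toU x)⁻¹ * h) := by group
      rw [this, mat_mul, hc]
      simp
    have : toU x ∈ scalars := toU_mem_scalars_of_near (norm_eq_one_of_scalar hc) fun i j => by
      simpa [hm] using hh i j
    exact Subtype.ext (hx.symm.trans ((QuotientGroup.eq_one_iff _).2 this))
  · rintro rfl
    exact ⟨1, fun i j => by simp [mat_one], rfl⟩

/-! ## The tiling -/

theorem mem_smul_DSig (g : U21) (p : H2C) :
    p ∈ (QuotientGroup.mk g : PU21) • DSig ↔ InD (mat g⁻¹ *ᵥ lift p) := by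
  rw [Set.mem_smul_set_iff_inv_smul_mem, ← QuotientGroup.mk_inv]
  conv_lhs => rw [← ofVec_lift p, smul_ofVec]
  exact ofVec_mem_DSig _

/-- The translates of the polyhedron are the cells of the orbit of `q∞`. -/
theorem mem_toPU_smul_DSig (x : FG) (p : H2C) :
    p ∈ toPU x • DSig ↔ ∀ y : FG, horo (lift p) (toU x) ≤ horo (lift p) (toU y) := by
  have e : ∀ g, horo (mat (toU x)⁻¹ *ᵥ lift p) g = horo (lift p) (toU x * g) := fun g => by
    rw [horo_mulVec, inv_inv]
  rw [toPU_apply, mem_smul_DSig]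
  constructor
  · intro h y
    have := InD.horo_one_le (by rw [herm_mulVec]; exact lift_neg p) h (x⁻¹ * y)
    rwa [e, e, mul_one, ← map_mul, mul_inv_cancel_left] at this
  · intro h k j _ _
    rw [e, e, mul_one]
    simpa using h (x * (ga ^ k * gb ^ j))

theorem toPU_smul_DSig_eq {x y : FG} (h : mat (toU x) *ᵥ qInf = mat (toU y) *ᵥ qInf) :
    toPU x • DSig = toPU y • DSig := by
  ext p
  simp only [mem_toPU_smul_DSig, horo, h]

theorem zpow_smul_DSig (k : ℤ) : toPU (ga ^ k) • DSig = DSig := by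
  have h : mat (toU (ga ^ k)) *ᵥ qInf = mat (toU 1) *ᵥ qInf := by
    rw [map_zpow, toU_ga, mat_A_zpow_qInf, map_one, mat_one, Matrix.one_mulVec]
  rw [toPU_smul_DSig_eq h, map_one, one_smul]

/-- If the cell of x contains q, then |⟨q, x q∞⟩| ≤ |⟨q, q∞⟩| = 1 for the normalized lift. With q in
a bounded neighbourhood away from the boundary, `finite_orbit` leaves finitely many x q∞, and the
cell depends only on x q∞. -/
theorem locallyFinite_DSig (p : H2C) :
    ∃ U ∈ 𝓝 p, {E : Set H2C | (∃ g ∈ Sig, E = g • DSig) ∧ (E ∩ U).Nonempty}.Finite := by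
  set u := -(herm (lift p) (lift p)).re / 2 with hu
  have hu0 : 0 < u := by linarith [lift_neg p]
  set M := ∑ i, ‖lift p i‖ + 1 with hM
  have h1 : ∀ᶠ q in 𝓝 p, (herm (lift q) (lift q)).re < -u :=
    (continuous_herm_self.comp continuous_lift).continuousAt.eventually_lt_const
      (show (herm (lift p) (lift p)).re < -u by linarith)
  have h2 : ∀ᶠ q in 𝓝 p, ∀ i, ‖lift q i‖ < M := by
    rw [eventually_all]
    intro i
    refine ((continuous_apply i).comp continuous_lift).norm.continuousAt.eventually_lt_const ?_
    have := Finset.single_le_sum (f := fun i => ‖lift p i‖) (fun i _ => norm_nonneg _)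
      (Finset.mem_univ i)
    simp only [Function.comp_apply] at *
    linarith
  refine ⟨_, h1.and h2, ((finite_orbit (u := u) (M := M) hu0 zero_le_one).image fun w =>
    {q : H2C | ∀ y : FG, ‖herm (lift q) w‖ ≤ horo (lift q) (toU y)}).subset ?_⟩
  rintro E ⟨⟨g, hg, rfl⟩, q, hq, hq1, hq2⟩
  obtain ⟨x, rfl⟩ := exists_toPU hg
  refine ⟨_, ⟨x, rfl, lift q, lift_two q, hq1.le, fun i => (hq2 i).le, ?_⟩, ?_⟩
  · have := (mem_toPU_smul_DSig x q).1 hq 1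
    rwa [map_one, horo_lift_one] at this
  · ext q'
    exact (mem_toPU_smul_DSig x q').symm

theorem isFundamentalDomainForCosets :
    IsFundamentalDomainForCosets (Subgroup.zpowers pA) Sig DSig where
  le := Subgroup.zpowers_le.2 (Subgroup.subset_closure (by simp))
  isClosed := isClosed_DSig
  connected_interior := interior_DSig ▸ isConnected_DInt
  closure_interior := closure_interior_DSig
  invariant := by
    rintro g hg
    obtain ⟨k, rfl⟩ := Subgroup.mem_zpowers_iff.1 hg
    rw [← toPU_ga, ← map_zpow, zpow_smul_DSig]
  covers p := by
    obtain ⟨x, hx⟩ := exists_horo_min (lift_neg p)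
    exact ⟨toPU x, toPU_mem x, (mem_toPU_smul_DSig x p).2 hx⟩
  disjoint g hg hgA := by
    obtain ⟨x, rfl⟩ := exists_toPU hg
    rw [Set.disjoint_left, interior_DSig]
    intro p hp hp'
    have h1 := (mem_toPU_smul_DSig x p).1 (interior_subset hp') 1
    rw [map_one] at h1
    refine absurd (InDStrict.horo_one_lt (lift_neg p) hp fun k hk => hgA ?_) (not_lt.2 h1)
    rw [hk, map_zpow, toPU_ga]
    exact Subgroup.zpow_mem_zpowers _ _
  locallyFinite := locallyFinite_DSig

/-- The presentation of `Σ`. -/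
noncomputable def presentation : FG ≃* Sig :=
  MulEquiv.ofBijective (toPU.codRestrict Sig toPU_mem)
    ⟨fun _ _ h => toPU_injective (congrArg Subtype.val h), fun g =>
      let ⟨x, hx⟩ := exists_toPU g.2
      ⟨x, Subtype.ext hx⟩⟩

end ChainLinks

theorem theorem3p1 :
    ChainLinks.IsFundamentalDomainForCosets (Subgroup.zpowers ChainLinks.pA) ChainLinks.Sig
        ChainLinks.DSig ∧
      DiscreteTopology ChainLinks.Sig ∧
      ∃ φ : PresentedGroup ({FreeGroup.of 1 ^ 4} : Set (FreeGroup (Fin 2))) ≃* ChainLinks.Sig,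
        (φ (PresentedGroup.of 0) : ChainLinks.PU21) = ChainLinks.pA ∧
        (φ (PresentedGroup.of 1) : ChainLinks.PU21) = ChainLinks.pB :=
  ⟨ChainLinks.isFundamentalDomainForCosets, ChainLinks.discreteTopology_Sig,
    ChainLinks.presentation, ChainLinks.toPU_ga, ChainLinks.toPU_gb⟩
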